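/- **Conventions.** All groups are profinite, homomorphisms are continuous, and $\twoheadrightarrow$ denotes an epimorphism. A cover of $G$ is an epimorphism $\eta\colon H\twoheadrightarrow G$; it is *indecomposable* if it is not an isomorphism and whenever $\eta=\rho\circ\psi$ with epimorphisms $\psi\colon H\twoheadrightarrow E$, $\rho\colon E\twoheadrightarrow G$, then $\psi$ or $\rho$ is an isomorphism. Covers $\eta\colon H\twoheadrightarrow G$ and $\pi\colon E\twoheadrightarrow G$ are isomorphic over $G$, $\eta\cong_G\pi$, if there is an isomorphism $\psi\colon H\to E$ with $\eta=\pi\circ\psi$. Let $G$ be a profinite group and let $(\eta_i\colon H_i\twoheadrightarrow G)_{i\in I}$ and $(\eta'_i\colon H'_i\twoheadrightarrow G)_{i\in I'}$ be families (of arbitrary cardinality, possibly empty) of indecomposable covers of $G$. Let $H$ be the fiber product of the $H_i$ over $G$, with structure map $\eta_I\colon H\twoheadrightarrow G$ (for $I=\emptyset$ it is $\mathrm{id}_G$), and define $\eta'_{I'}\colon H'\twoheadrightarrow G$ similarly. For an indecomposable cover $\zeta$ of $G$ with non-abelian kernel let $I_\zeta=\{i\in I : \eta_i\cong_G\zeta\}$.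 For a finite simple $G$-module $A$ let $F_A=\mathrm{End}_G(A)$, let $I_A=\{i\in I : \operatorname{Ker}\eta_i\cong A \text{ as } G\text{-modules}\}$ ($G$ acts on an abelian kernel through conjugation), let $H_A$ be the fiber product of $(\eta_i)_{i\in I_A}$ over $G$, let $B_A=\operatorname{Ker}(H_A\twoheadrightarrow G)$, let $f_A\in H^2(G,B_A)$ be the continuous cohomology class of the extension $1\to B_A\to H_A\to G\to1$, and let $V_A=\mathrm{Hom}_G(B_A,A)$ (continuous $G$-homomorphisms), an $F_A$-vector space. Let $S_A\colon V_A\to H^2(G,A)$ be the $F_A$-linear map $\varphi\mapsto\varphi_*(f_A)$. Define $I'_\zeta$, $I'_A$, $V'_A$, $S'_A$ in the same way from the second family. **Theorem.** 1. There is an epimorphism $\theta\colon H\twoheadrightarrow H'$ with $\eta'_{I'}\circ\theta=\eta_I$ if and only if (a) $|I'_\zeta|\le|I_\zeta|$ for every indecomposable cover $\zeta$ of $G$ with non-abelian kernel, and (b) $\operatorname{Im}S'_A\subseteq\operatorname{Im}S_A$ and $\dim_{F_A}\operatorname{Ker}S'_A\le\dim_{F_A}\operatorname{Ker}S_A$ for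 every finite simple $G$-module $A$. 2. There is an isomorphism $\theta\colon H\to H'$ with $\eta'_{I'}\circ\theta=\eta_I$ if and only if (a) $|I_\zeta|=|I'_\zeta|$ for every indecomposable cover $\zeta$ of $G$ with non-abelian kernel, and (b) $\operatorname{Im}S_A=\operatorname{Im}S'_A$ and $\dim_{F_A}\operatorname{Ker}S_A=\dim_{F_A}\operatorname{Ker}S'_A$ for every finite simple $G$-module $A$. 3. If there are epimorphisms $\rho\colon H\twoheadrightarrow H'$ and $\rho'\colon H'\twoheadrightarrow H$ with $\eta'_{I'}\circ\rho=\eta_I$ and $\eta_I\circ\rho'=\eta'_{I'}$, then there is an isomorphism $\theta\colon H\to H'$ with $\eta'_{I'}\circ\theta=\eta_I$. Here cardinalities and dimensions are cardinal numbers. -/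

import Mathlib

universe u

/-- A cover of a profinite group `G`: an epimorphism (continuous surjective homomorphism) from a
profinite group onto `G`. -/
structure ProfiniteCover (G : ProfiniteGrp.{u}) where
  /-- the covering group -/
  dom : ProfiniteGrp.{u}
  /-- the epimorphism onto `G` -/
  map : dom →ₜ* G
  surj : Function.Surjective map

namespace ProfiniteCover

/-- `η` dominates `π`: there is an epimorphism `ψ` of profinite groups with `η = π ∘ ψ`. -/
def Dominates {G : ProfiniteGrp.{u}} (η π : ProfiniteCover G) : Prop :=
  ∃ ψ : η.dom →ₜ* π.dom, Function.Surjective ψ ∧ ∀ x, π.map (ψ x) = η.map x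

/-- `η` and `π` are isomorphic over `G`. -/
def IsIso {G : ProfiniteGrp.{u}} (η π : ProfiniteCover G) : Prop :=
  ∃ e : η.dom ≃ₜ* π.dom, ∀ x, π.map (e x) = η.map x

/-- A cover is indecomposable if it is not an isomorphism and in every factorization into two
epimorphisms of profinite groups one of them is an isomorphism. (A continuous homomorphism of
profinite groups is an isomorphism if and only if it is bijective.) -/
def IsIndecomposable {G : ProfiniteGrp.{u}} (η : ProfiniteCover G) : Prop :=
  ¬ Function.Bijective η.map ∧
    ∀ (E : ProfiniteGrp.{u}) (ψ : η.dom →ₜ* E) (ρ : E →ₜ* G),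
      Function.Surjective ψ → Function.Surjective ρ → (∀ x, ρ (ψ x) = η.map x) →
        Function.Bijective ψ ∨ Function.Bijective ρ

/-- The kernel of a cover. -/
abbrev ker {G : ProfiniteGrp.{u}} (η : ProfiniteCover G) : Subgroup η.dom :=
  η.map.toMonoidHom.ker

/-- The kernel is abelian. -/
def HasAbelianKernel {G : ProfiniteGrp.{u}} (η : ProfiniteCover G) : Prop :=
  ∀ x ∈ η.ker, ∀ y ∈ η.ker, x * y = y * x

/-! ### Fiber products -/

/-- The fiber product over `G` of a family of covers, as a group. The coordinate in `G` records
the common image, so that the fiber product of the empty family is `G`; for a nonempty family it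
is redundant. -/
def fiberProductSubgroup {G : ProfiniteGrp.{u}} {I : Type u} (η : I → ProfiniteCover G) :
    Subgroup (G × ∀ i, (η i).dom) where
  carrier := {x | ∀ i, (η i).map (x.2 i) = x.1}
  mul_mem' {x y} hx hy i := by simp [hx i, hy i]
  one_mem' i := by simp
  inv_mem' {x} hx i := by simp [hx i]

theorem isClosed_fiberProductSubgroup {G : ProfiniteGrp.{u}} {I : Type u}
    (η : I → ProfiniteCover G) :
    IsClosed (fiberProductSubgroup η : Set (G × ∀ i, (η i).dom)) := by
  have : (fiberProductSubgroup η : Set (G × ∀ i, (η i).dom)) =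
      ⋂ i, {x | (η i).map (x.2 i) = x.1} := by
    ext x
    simp [fiberProductSubgroup]
  rw [this]
  refine isClosed_iInter fun i => isClosed_eq ?_ continuous_fst
  exact (η i).map.continuous_toFun.comp ((continuous_apply i).comp continuous_snd)

instance compactSpace_fiberProductSubgroup {G : ProfiniteGrp.{u}} {I : Type u}
    (η : I → ProfiniteCover G) : CompactSpace (fiberProductSubgroup η) :=
  isCompact_iff_compactSpace.mp (isClosed_fiberProductSubgroup η).isCompact

/-- The fiber product over `G` of a family of covers of `G`, with its structure map to `G`. -/
def fiberProduct {G : ProfiniteGrp.{u}} {I : Type u} (η : I → ProfiniteCover G) :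
    ProfiniteCover G where
  dom := ProfiniteGrp.of (fiberProductSubgroup η)
  map :=
    { toFun := fun x => x.1.1
      map_one' := rfl
      map_mul' := fun _ _ => rfl
      continuous_toFun := continuous_fst.comp continuous_subtype_val }
  surj g := ⟨⟨(g, fun i => ((η i).surj g).choose), fun i => ((η i).surj g).choose_spec⟩, rfl⟩

/-- The cover admits a continuous set-theoretic section. -/
def HasContinuousSection {G : ProfiniteGrp.{u}} (η : ProfiniteCover G) : Prop :=
  ∃ u : G → η.dom, Continuous u ∧ ∀ g, η.map (u g) = g

/-- A cover whose kernel meets some open normal subgroup trivially has a continuous section. -/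
theorem hasContinuousSection_of_inf_eq_bot {G : ProfiniteGrp.{u}} (η : ProfiniteCover G)
    (U : OpenNormalSubgroup η.dom) (hU : ∀ x ∈ U, η.map x = 1 → x = 1) :
    η.HasContinuousSection := by
  classical
  let f : η.dom →* G := η.map.toMonoidHom
  have hcont : Continuous f := η.map.continuous_toFun
  have hmem : ∀ x, x ∈ U ↔ x ∈ U.toSubgroup := fun x => Iff.rfl
  let W : Subgroup η.dom := (U.toSubgroup.map f).comap f
  have hUW : U.toSubgroup ≤ W := Subgroup.le_comap_map _ _
  have hW : IsOpen (W : Set η.dom) := Subgroup.isOpen_mono hUW U.isOpen'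
  have : DiscreteTopology (η.dom ⧸ W) := QuotientGroup.discreteTopology hW
  let t : η.dom → η.dom := fun h => (QuotientGroup.mk h : η.dom ⧸ W).out
  have ht : Continuous t :=
    (continuous_of_discreteTopology (f := fun q : η.dom ⧸ W => q.out)).comp
      QuotientGroup.continuous_mk
  have htW : ∀ h, (t h)⁻¹ * h ∈ W := fun h =>
    QuotientGroup.eq.mp (QuotientGroup.out_eq' (QuotientGroup.mk h : η.dom ⧸ W))
  have htc : ∀ h h', h⁻¹ * h' ∈ W → t h = t h' := fun h h' hh => by
    have : (QuotientGroup.mk h : η.dom ⧸ W) = QuotientGroup.mk h' := QuotientGroup.eq.mpr hh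
    simp only [t, this]
  let T : Set η.dom := {h | (t h)⁻¹ * h ∈ U.toSubgroup}
  have hUc : IsClosed (U.toSubgroup : Set η.dom) := Subgroup.isClosed_of_isOpen _ U.isOpen'
  have hT : IsClosed T := hUc.preimage (ht.inv.mul continuous_id)
  have : CompactSpace T := isCompact_iff_compactSpace.mp hT.isCompact
  let p : T → G := fun h => f h
  have hp : Continuous p := hcont.comp continuous_subtype_val
  have hbij : Function.Bijective p := by
    constructor
    · rintro ⟨a, ha⟩ ⟨b, hb⟩ hab
      have hab' : f a = f b := hab
      have h1 : f (a⁻¹ * b) = 1 := by simp [hab']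
      have h2 : t a = t b := htc a b (by
        change f (a⁻¹ * b) ∈ U.toSubgroup.map f
        rw [h1]
        exact one_mem _)
      have h3 : a⁻¹ * b ∈ U.toSubgroup := by
        have hb' : (t a)⁻¹ * b ∈ U.toSubgroup := by rw [h2]; exact hb
        have := mul_mem (inv_mem (show (t a)⁻¹ * a ∈ U.toSubgroup from ha)) hb'
        simpa [mul_assoc] using this
      have h4 : a⁻¹ * b = 1 := hU _ h3 h1
      exact Subtype.ext (inv_mul_eq_one.mp h4)
    · intro g
      obtain ⟨h, rfl⟩ := η.surj g
      obtain ⟨x, hx, hxe⟩ : ∃ x ∈ U.toSubgroup, f x = f ((t h)⁻¹ * h) := htW h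
      have h1 : f (t h * x) = f h := by simp [hxe]
      have h2 : t (t h * x) = t h := (htc h (t h * x) (by
        change f (h⁻¹ * (t h * x)) ∈ U.toSubgroup.map f
        rw [map_mul, h1, map_inv, inv_mul_cancel]
        exact one_mem _)).symm
      refine ⟨⟨t h * x, ?_⟩, h1⟩
      change (t (t h * x))⁻¹ * (t h * x) ∈ U.toSubgroup
      rw [h2, inv_mul_cancel_left]
      exact hx
  let e : T ≃ₜ G := hp.homeoOfEquivCompactToT2 (f := Equiv.ofBijective p hbij)
  exact ⟨fun g => (e.symm g : η.dom), continuous_subtype_val.comp e.symm.continuous,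
    fun g => e.apply_symm_apply g⟩

/-- An indecomposable cover has a continuous section. -/
theorem IsIndecomposable.hasContinuousSection {G : ProfiniteGrp.{u}} {η : ProfiniteCover G}
    (h : η.IsIndecomposable) : η.HasContinuousSection := by
  classical
  have hcont : Continuous η.map := η.map.continuous_toFun
  obtain ⟨k, hk, hk1⟩ : ∃ k, η.map k = 1 ∧ k ≠ 1 := by
    by_contra! hc
    exact h.1 ⟨(injective_iff_map_eq_one η.map).mpr hc, η.surj⟩
  obtain ⟨U, hU⟩ := ProfiniteGrp.exist_openNormalSubgroup_sub_open_nhds_of_one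
    (isOpen_compl_singleton (x := k)) (by simpa using hk1.symm)
  have hkU : k ∉ U.toSubgroup := fun hmem => hU hmem rfl
  have : DiscreteTopology (η.dom ⧸ U.toSubgroup) := QuotientGroup.discreteTopology U.isOpen'
  let ψ' : η.dom →* G × (η.dom ⧸ U.toSubgroup) :=
    η.map.toMonoidHom.prod (QuotientGroup.mk' U.toSubgroup)
  have hψ' : Continuous ψ' := hcont.prodMk QuotientGroup.continuous_mk
  have : CompactSpace ψ'.range := by
    refine isCompact_iff_compactSpace.mp ?_
    rw [MonoidHom.coe_range]
    exact isCompact_range hψ'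
  let ψ : η.dom →ₜ* ProfiniteGrp.of ψ'.range :=
    { ψ'.rangeRestrict with
      continuous_toFun := hψ'.subtype_mk _ }
  let ρ : ProfiniteGrp.of ψ'.range →ₜ* G :=
    { toFun := fun x => x.1.1
      map_one' := rfl
      map_mul' := fun _ _ => rfl
      continuous_toFun := continuous_fst.comp continuous_subtype_val }
  have hρψ : ∀ x, ρ (ψ x) = η.map x := fun _ => rfl
  have hψs : Function.Surjective ψ := ψ'.rangeRestrict_surjective
  have hρs : Function.Surjective ρ := fun g => by
    obtain ⟨x, rfl⟩ := η.surj g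
    exact ⟨ψ x, rfl⟩
  rcases h.2 _ ψ ρ hψs hρs hρψ with hb | hb
  · refine hasContinuousSection_of_inf_eq_bot η U fun x hx hx1 => hb.1 ?_
    apply Subtype.ext
    refine Prod.ext ?_ ?_
    · exact hx1.trans (map_one η.map).symm
    · change (QuotientGroup.mk x : η.dom ⧸ U.toSubgroup) = QuotientGroup.mk 1
      exact ((QuotientGroup.eq_one_iff x).mpr hx).trans rfl
  · exfalso
    have h1 : ψ k = ψ 1 := hb.1 (by rw [hρψ, hρψ, hk, map_one])
    have h2 : (QuotientGroup.mk k : η.dom ⧸ U.toSubgroup) = QuotientGroup.mk 1 :=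
      congrArg (fun y => y.1.2) h1
    exact hkU ((QuotientGroup.eq_one_iff k).mp h2)

/-- A fiber product of covers with continuous sections has a continuous section. -/
theorem hasContinuousSection_fiberProduct {G : ProfiniteGrp.{u}} {I : Type u}
    (η : I → ProfiniteCover G) (h : ∀ i, (η i).HasContinuousSection) :
    (fiberProduct η).HasContinuousSection := by
  choose s hs hs' using h
  exact ⟨fun g => ⟨(g, fun i => s i g), fun i => hs' i g⟩,
    (continuous_id.prodMk (continuous_pi hs)).subtype_mk _, fun _ => rfl⟩

end ProfiniteCover

/-! ### Simple modules and continuous cohomology in degree two -/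

/-- A `G`-module is simple if it is nonzero and has no `G`-submodules besides `0` and itself. -/
def IsSimpleGModule (G A : Type*) [Group G] [AddCommGroup A] [DistribMulAction G A] : Prop :=
  Nontrivial A ∧
    ∀ B : AddSubgroup A, (∀ (g : G), ∀ b ∈ B, g • b ∈ B) → B = ⊥ ∨ B = ⊤

/-- The ring `F_A = End_G(A)` of endomorphisms of the `G`-module `A`. -/
def gEnd (G A : Type*) [Group G] [AddCommGroup A] [DistribMulAction G A] :
    Subring (AddMonoid.End A) where
  carrier := {α | ∀ (g : G) (a : A), α (g • a) = g • α a}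
  mul_mem' {α β} hα hβ g a := by
    change α (β (g • a)) = g • α (β a)
    rw [hβ g a, hα]
  one_mem' _ _ := rfl
  add_mem' {α β} hα hβ g a := by
    change α (g • a) + β (g • a) = g • (α a + β a)
    rw [hα g a, hβ g a, smul_add]
  zero_mem' g a := (smul_zero g).symm
  neg_mem' {α} hα g a := by
    change -α (g • a) = g • (-α a)
    rw [hα g a, smul_neg]

section Cohomology

variable (G A : Type*) [Group G] [TopologicalSpace G] [AddCommGroup A] [TopologicalSpace A]
  [DiscreteTopology A] [DistribMulAction G A]

/-- The continuous (inhomogeneous) 2-cocycles of `G` with values in the discrete `G`-module `A`,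
as a module over `End_G(A)`, which acts on values. -/
def twoCocycles : Submodule (gEnd G A) (G → G → A) where
  carrier := {f | Continuous (fun x : G × G => f x.1 x.2) ∧
    ∀ σ τ ρ, σ • f τ ρ - f (σ * τ) ρ + f σ (τ * ρ) - f σ τ = 0}
  add_mem' {f f'} hf hf' := by
    refine ⟨hf.1.add hf'.1, fun σ τ ρ => ?_⟩
    have h := congrArg₂ (· + ·) (hf.2 σ τ ρ) (hf'.2 σ τ ρ)
    simp only [add_zero] at h
    simp only [Pi.add_apply, smul_add]
    rw [← h]
    abel
  zero_mem' := ⟨continuous_const, fun σ τ ρ => by simp⟩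
  smul_mem' α f hf := by
    refine ⟨(continuous_of_discreteTopology (f := fun a : A => α • a)).comp hf.1,
      fun σ τ ρ => ?_⟩
    have h := congrArg α.1 (hf.2 σ τ ρ)
    simp only [map_sub, map_add, map_zero, α.2 σ] at h
    exact h

/-- The continuous 2-coboundaries, as a submodule of the 2-cocycles. -/
def twoCoboundaries : Submodule (gEnd G A) (twoCocycles G A) where
  carrier := {f | ∃ c : G → A, Continuous c ∧
    ∀ σ τ, f.1 σ τ = σ • c τ - c (σ * τ) + c σ}
  add_mem' {f f'} := by
    rintro ⟨c, hc, h⟩ ⟨c', hc', h'⟩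
    refine ⟨c + c', hc.add hc', fun σ τ => ?_⟩
    change f.1 σ τ + f'.1 σ τ = _
    rw [h, h']
    simp only [Pi.add_apply, smul_add]
    abel
  zero_mem' := ⟨0, continuous_const, fun σ τ => by simp⟩
  smul_mem' α f := by
    rintro ⟨c, hc, h⟩
    refine ⟨fun σ => α • c σ,
      (continuous_of_discreteTopology (f := fun a : A => α • a)).comp hc, fun σ τ => ?_⟩
    have h' := congrArg α.1 (h σ τ)
    simp only [map_sub, map_add, α.2 σ] at h'
    exact h'

/-- The continuous cohomology group `H²(G, A)`, as a module over `End_G(A)`. -/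
abbrev ContH2 : Type _ := twoCocycles G A ⧸ twoCoboundaries G A

end Cohomology

namespace ProfiniteCover

section Invariants

variable {G : ProfiniteGrp.{u}} (η : ProfiniteCover G) (A : Type u) [AddCommGroup A]
  [TopologicalSpace A] [DiscreteTopology A] [DistribMulAction G A]

/-- The kernel of `η` is isomorphic to `A` as a `G`-module, where `g` in `G` acts on the kernel as
conjugation by any preimage of `g`. (In particular the kernel is then abelian.) -/
def KerIso (η : ProfiniteCover G) (A : Type u) [AddCommGroup A] [DistribMulAction G A] : Prop :=
  ∃ e : Additive η.ker ≃+ A, ∀ (h : η.dom) (k : η.ker),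
    e (Additive.ofMul (MulAut.conjNormal h k)) = η.map h • e (Additive.ofMul k)

/-- `K^* = Hom_G(K, A)` for the kernel `K` of `η`: continuous homomorphisms `K → A` that commute
with the action of `G`, where `g` in `G` acts on `K` as conjugation by any preimage of `g`;
a module over `End_G(A)`. -/
def kerDual : Submodule (gEnd G A) (η.ker → A) where
  carrier := {φ | Continuous φ ∧ (∀ k k', φ (k * k') = φ k + φ k') ∧
    ∀ (h : η.dom) (k : η.ker), φ (MulAut.conjNormal h k) = η.map h • φ k}
  add_mem' {φ φ'} hφ hφ' := by
    refine ⟨hφ.1.add hφ'.1, fun k k' => ?_, fun h k => ?_⟩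
    · simp only [Pi.add_apply, hφ.2.1, hφ'.2.1]
      abel
    · simp only [Pi.add_apply, hφ.2.2, hφ'.2.2, smul_add]
  zero_mem' := ⟨continuous_const, fun k k' => by simp, fun h k => by simp⟩
  smul_mem' α φ hφ := by
    refine ⟨(continuous_of_discreteTopology (f := fun a : A => α • a)).comp hφ.1,
      fun k k' => ?_, fun h k => ?_⟩
    · change α.1 (φ (k * k')) = α.1 (φ k) + α.1 (φ k')
      rw [hφ.2.1, map_add]
    · change α.1 (φ (MulAut.conjNormal h k)) = η.map h • α.1 (φ k)
      rw [hφ.2.2, α.2]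

variable {η}

/-- The factor set `f(σ, τ) = u(σ) u(τ) u(στ)⁻¹` in the kernel, for a section `u` of `η`; it
represents the class in `H²(G, ker η)` of the extension `η` when the kernel is abelian. -/
def factorSet (u : G → η.dom) (hu : ∀ g, η.map (u g) = g) (σ τ : G) : η.ker :=
  ⟨u σ * u τ * (u (σ * τ))⁻¹, by
    change η.map (u σ * u τ * (u (σ * τ))⁻¹) = 1
    rw [map_mul, map_mul, map_inv, hu, hu, hu, mul_inv_cancel]⟩

variable {A}

theorem comp_factorSet_mem (u : G → η.dom) (hc : Continuous u) (hu : ∀ g, η.map (u g) = g)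
    (φ : kerDual η A) : (fun σ τ => φ.1 (factorSet u hu σ τ)) ∈ twoCocycles G A := by
  obtain ⟨φ, hφ, hmul, hconj⟩ := φ
  constructor
  · refine hφ.comp (Continuous.subtype_mk ?_ _)
    exact ((hc.comp continuous_fst).mul (hc.comp continuous_snd)).mul
      (hc.comp (continuous_fst.mul continuous_snd)).inv
  · intro σ τ ρ
    have key : MulAut.conjNormal (u σ) (factorSet u hu τ ρ) * factorSet u hu σ (τ * ρ) =
        factorSet u hu σ τ * factorSet u hu (σ * τ) ρ := by
      apply Subtype.ext
      simp only [Subgroup.coe_mul, MulAut.conjNormal_apply, factorSet, mul_assoc]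
      group
    have h := congrArg φ key
    rw [hmul, hmul, hconj, hu] at h
    change σ • φ (factorSet u hu τ ρ) - φ (factorSet u hu (σ * τ) ρ) +
      φ (factorSet u hu σ (τ * ρ)) - φ (factorSet u hu σ τ) = 0
    rw [sub_add_eq_add_sub, h]
    abel

/-- The linear map `K^* → H²(G, A)`, `φ ↦ φ ∘ f`, for the factor set `f` of a continuous section
of `η`. -/
def dualToH2OfSection (u : G → η.dom) (hc : Continuous u) (hu : ∀ g, η.map (u g) = g) :
    kerDual η A →ₗ[gEnd G A] ContH2 G A :=
  (twoCoboundaries G A).mkQ ∘ₗ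
    { toFun := fun φ => ⟨fun σ τ => φ.1 (factorSet u hu σ τ), comp_factorSet_mem u hc hu φ⟩
      map_add' := fun _ _ => rfl
      map_smul' := fun _ _ => rfl }

/-- The map does not depend on the section. -/
theorem dualToH2OfSection_eq (u u' : G → η.dom) (hc : Continuous u) (hc' : Continuous u')
    (hu : ∀ g, η.map (u g) = g) (hu' : ∀ g, η.map (u' g) = g) :
    dualToH2OfSection (A := A) u hc hu = dualToH2OfSection u' hc' hu' := by
  ext φ
  refine (Submodule.Quotient.eq _).mpr ?_
  let d : G → η.ker := fun g => ⟨u g * (u' g)⁻¹, by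
    change η.map (u g * (u' g)⁻¹) = 1
    rw [map_mul, map_inv, hu, hu', mul_inv_cancel]⟩
  have hd : Continuous d := (hc.mul hc'.inv).subtype_mk _
  refine ⟨fun g => φ.1 (d g), φ.2.1.comp hd, fun σ τ => ?_⟩
  have key : factorSet u hu σ τ * d (σ * τ) =
      d σ * MulAut.conjNormal (u' σ) (d τ) * factorSet u' hu' σ τ := by
    apply Subtype.ext
    simp only [Subgroup.coe_mul, MulAut.conjNormal_apply, factorSet, d, mul_assoc]
    group
  have h := congrArg φ.1 key
  rw [φ.2.2.1, φ.2.2.1, φ.2.2.1, φ.2.2.2, hu'] at h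
  change φ.1 (factorSet u hu σ τ) - φ.1 (factorSet u' hu' σ τ) =
    σ • φ.1 (d τ) - φ.1 (d (σ * τ)) + φ.1 (d σ)
  rw [eq_sub_of_add_eq h]
  abel

/-- The linear map `S : K^* → H²(G, A)` attached to a cover `η` with kernel `K`: it sends `φ` to
`φ_* f`, where `f` is the class of the extension `η`. -/
noncomputable def dualToH2 (h : η.HasContinuousSection) :
    kerDual η A →ₗ[gEnd G A] ContH2 G A :=
  dualToH2OfSection h.choose h.choose_spec.1 h.choose_spec.2

end Invariants

section FamilyInvariants

variable {G : ProfiniteGrp.{u}} {I : Type u} (η : I → ProfiniteCover G)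

/-- `I_ζ`: the indices of the members of the family that are isomorphic to `ζ`. -/
abbrev IsoIndex (ζ : ProfiniteCover G) : Type u := {i : I // (η i).IsIso ζ}

variable (A : Type u) [AddCommGroup A] [DistribMulAction G A]

/-- `I_A`: the indices of the members of the family whose kernel is isomorphic to `A`. -/
abbrev ModuleIndex : Type u := {i : I // (η i).KerIso A}

/-- `H_A → G`: the fiber product of the members of the family whose kernel is isomorphic
to `A`. -/
abbrev isotypicPart : ProfiniteCover G := fiberProduct fun i : ModuleIndex η A => η i

variable {η} [TopologicalSpace A] [DiscreteTopology A]

/-- The linear map `S_A : V_A → H²(G, A)`, where `V_A = Hom_G(B_A, A)` and `B_A` is the kernel of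
`H_A → G`. -/
noncomputable def isotypicMap (hη : ∀ i, (η i).IsIndecomposable) :
    kerDual (isotypicPart η A) A →ₗ[gEnd G A] ContH2 G A :=
  dualToH2 (hasContinuousSection_fiberProduct _ fun i => (hη i).hasContinuousSection)

end FamilyInvariants

end ProfiniteCover

/-! All invariants can be read off the cover H → G itself. For a simple module A, a continuous
G-homomorphism from the kernel of H → G to A has open kernel, so it is a finite sum of homomorphisms
through coordinates, and only coordinates with kernel isomorphic to A contribute. Hence V_A is the
full dual Hom_G(Ker(H → G), A), and S_A pushes the class of H forward (`range_isotypicMap`,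
`rank_ker_isotypicMap`). An epimorphism H → H' over G embeds V'_A in V_A compatibly with S'_A and
S_A, which makes (b) necessary. An indecomposable quotient of H with non-abelian kernel has the same
kernel as some projection (`exists_proj_eq_one_iff`), because commutators make such a kernel behave
like a prime ideal; this makes (a) necessary.

Conversely, over the division ring F_A condition (b) gives an injective j : V'_A → V_A with S_A ∘ j
= S'_A. If η'_i has abelian kernel A, its coordinate homomorphism is carried by j to a homomorphism
on the kernel of H with the class of the extension η'_i, so the latter extends to a homomorphism to
H'_i over G (`exists_dualMap_eq`). Non-abelian factors are matched with projections through (a). The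
resulting map to H' is onto by compactness, once no component kills the common kernel of finitely
many others: this follows from injectivity of j in the abelian case and from primeness in the
non-abelian one. If equalities hold, j is bijective and the map is injective as well. Part 3 follows
since inequalities in both directions are equalities. -/

section LinearAlgebra

/-! ### Linear algebra over a division ring -/

variable {K V V' W : Type u} [DivisionRing K] [AddCommGroup V] [Module K V] [AddCommGroup V']
  [Module K V'] [AddCommGroup W] [Module K W]

/-- Modify a lift of `S'` along `S` by a prescribed map on the kernel of `S'`. -/
theorem exists_linearMap_comp_eq_of_range_le (S : V →ₗ[K] W) (S' : V' →ₗ[K] W)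
    (hr : LinearMap.range S' ≤ LinearMap.range S)
    (k : LinearMap.ker S' →ₗ[K] LinearMap.ker S) :
    ∃ j : V' →ₗ[K] V, S ∘ₗ j = S' ∧ ∀ x : LinearMap.ker S', j x = k x := by
  obtain ⟨p, hp⟩ := (LinearMap.ker S').subtype.exists_leftInverse_of_injective
    (Submodule.ker_subtype _)
  have hp' : ∀ x : LinearMap.ker S', p x = x := fun x => LinearMap.congr_fun hp x
  obtain ⟨g, hg⟩ := Module.projective_lifting_property S.rangeRestrict
    (S'.codRestrict (LinearMap.range S) fun x => hr ⟨x, rfl⟩) S.surjective_rangeRestrict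
  have hg' : ∀ x, S (g x) = S' x := fun x => congrArg Subtype.val (LinearMap.congr_fun hg x)
  refine ⟨g ∘ₗ (LinearMap.id - (LinearMap.ker S').subtype ∘ₗ p) +
    (LinearMap.ker S).subtype ∘ₗ k ∘ₗ p, ?_, fun x => ?_⟩
  · ext x
    have h1 : S (k (p x)) = 0 := (k (p x)).2
    have h2 : S' (p x) = 0 := (p x).2
    simp [hg', h1, h2]
  · simp [hp']

/-- The equation `S ∘ j = S'` confines the kernel of `j` to that of `S'`, where `j` is a prescribed
injection into the kernel of `S`. -/
theorem exists_injective_comp_eq_of_divisionRing (S : V →ₗ[K] W) (S' : V' →ₗ[K] W)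
    (hr : LinearMap.range S' ≤ LinearMap.range S)
    (hk : Module.rank K (LinearMap.ker S') ≤ Module.rank K (LinearMap.ker S)) :
    ∃ j : V' →ₗ[K] V, Function.Injective j ∧ ∀ x, S (j x) = S' x := by
  obtain ⟨k, hk⟩ := rank_le_iff_exists_linearMap.mp hk
  obtain ⟨j, hj, hjk⟩ := exists_linearMap_comp_eq_of_range_le S S' hr k
  have hj' : ∀ x, S (j x) = S' x := fun x => LinearMap.congr_fun hj x
  refine ⟨j, (injective_iff_map_eq_zero j).mpr fun x hx => ?_, hj'⟩
  have hx' : S' x = 0 := by rw [← hj', hx, map_zero]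
  have h1 : (k ⟨x, hx'⟩ : V) = 0 := (hjk ⟨x, hx'⟩).symm.trans hx
  have h2 : (⟨x, hx'⟩ : LinearMap.ker S') = 0 :=
    hk ((Subtype.ext h1).trans (map_zero k).symm)
  exact congrArg Subtype.val h2

theorem exists_bijective_comp_eq_of_divisionRing (S : V →ₗ[K] W) (S' : V' →ₗ[K] W)
    (hr : LinearMap.range S' = LinearMap.range S)
    (hk : Module.rank K (LinearMap.ker S') = Module.rank K (LinearMap.ker S)) :
    ∃ j : V' →ₗ[K] V, Function.Bijective j ∧ ∀ x, S (j x) = S' x := by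
  obtain ⟨k⟩ := nonempty_linearEquiv_of_rank_eq hk
  obtain ⟨j, hj, hjk⟩ := exists_linearMap_comp_eq_of_range_le S S' hr.le k.toLinearMap
  have hj' : ∀ x, S (j x) = S' x := fun x => LinearMap.congr_fun hj x
  refine ⟨j, ⟨(injective_iff_map_eq_zero j).mpr fun x hx => ?_, fun w => ?_⟩, hj'⟩
  · have hx' : S' x = 0 := by rw [← hj', hx, map_zero]
    have h1 : (k ⟨x, hx'⟩ : V) = 0 := (hjk ⟨x, hx'⟩).symm.trans hx
    have h2 : (⟨x, hx'⟩ : LinearMap.ker S') = 0 :=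
      k.injective ((Subtype.ext h1).trans (map_zero k).symm)
    exact congrArg Subtype.val h2
  -- Lift `S w` through `S'` to `v`; the error `w - j v` lies in the kernel of `S`, which `j`
  -- covers.
  · obtain ⟨v, hv⟩ : S w ∈ LinearMap.range S' := hr ▸ ⟨w, rfl⟩
    have hw : S (w - j v) = 0 := by rw [map_sub, hj', hv, sub_self]
    refine ⟨v + k.symm ⟨w - j v, hw⟩, ?_⟩
    rw [map_add, hjk]
    simp

end LinearAlgebra

section LinearAlgebraOfIsUnit

/-- The division ring must extend the given ring structure on the nose, so that substituting it
leaves the module structures over `gEnd G A` untouched. -/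
theorem exists_divisionRing_toRing_eq {K : Type*} [R : Ring K] [Nontrivial K]
    (h : ∀ a : K, IsUnit a ∨ a = 0) : ∃ D : DivisionRing K, D.toRing = R :=
  ⟨DivisionRing.ofIsUnitOrEqZero h, rfl⟩

variable {K V V' W : Type u} [Ring K] [AddCommGroup V] [Module K V] [AddCommGroup V']
  [Module K V'] [AddCommGroup W] [Module K W]

theorem exists_injective_comp_eq [Nontrivial K] (h : ∀ a : K, IsUnit a ∨ a = 0)
    (S : V →ₗ[K] W) (S' : V' →ₗ[K] W) (hr : LinearMap.range S' ≤ LinearMap.range S)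
    (hk : Module.rank K (LinearMap.ker S') ≤ Module.rank K (LinearMap.ker S)) :
    ∃ j : V' →ₗ[K] V, Function.Injective j ∧ ∀ x, S (j x) = S' x := by
  obtain ⟨D, rfl⟩ := exists_divisionRing_toRing_eq h
  exact exists_injective_comp_eq_of_divisionRing S S' hr hk

theorem exists_bijective_comp_eq [Nontrivial K] (h : ∀ a : K, IsUnit a ∨ a = 0)
    (S : V →ₗ[K] W) (S' : V' →ₗ[K] W) (hr : LinearMap.range S' = LinearMap.range S)
    (hk : Module.rank K (LinearMap.ker S') = Module.rank K (LinearMap.ker S)) :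
    ∃ j : V' →ₗ[K] V, Function.Bijective j ∧ ∀ x, S (j x) = S' x := by
  obtain ⟨D, rfl⟩ := exists_divisionRing_toRing_eq h
  exact exists_bijective_comp_eq_of_divisionRing S S' hr hk

end LinearAlgebraOfIsUnit

section Schur

variable {G A : Type*} [Group G] [AddCommGroup A] [DistribMulAction G A]

/-- Schur's lemma. -/
theorem IsSimpleGModule.isUnit_or_eq_zero (h : IsSimpleGModule G A) (α : gEnd G A) :
    IsUnit α ∨ α = 0 := by
  refine or_iff_not_imp_right.mpr fun h0 => ?_
  have hker : α.1.ker = ⊥ := by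
    refine (h.2 α.1.ker fun g b hb => ?_).resolve_right fun ht => h0 ?_
    · have hb' : α.1 b = 0 := hb
      change α.1 (g • b) = 0
      rw [α.2, hb', smul_zero]
    · refine Subtype.ext (AddMonoidHom.ext fun a => ?_)
      exact (ht ▸ AddSubgroup.mem_top a : a ∈ α.1.ker)
  have hrange : α.1.range = ⊤ := by
    refine (h.2 α.1.range ?_).resolve_left fun hb => h0 ?_
    · rintro g _ ⟨a, rfl⟩
      exact ⟨g • a, α.2 g a⟩
    · refine Subtype.ext (AddMonoidHom.ext fun a => ?_)
      exact (AddSubgroup.mem_bot.mp (hb ▸ ⟨a, rfl⟩ : α.1 a ∈ (⊥ : AddSubgroup A)))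
  let e : A ≃+ A := AddEquiv.ofBijective α.1
    ⟨(AddMonoidHom.ker_eq_bot_iff α.1).mp hker, AddMonoidHom.range_eq_top.mp hrange⟩
  have he : ∀ a, α.1 (e.symm a) = a := e.apply_symm_apply
  have he' : ∀ a, e.symm (α.1 a) = a := e.symm_apply_apply
  let β : gEnd G A := ⟨e.symm.toAddMonoidHom, fun g a => by
    change e.symm (g • a) = g • e.symm a
    rw [AddEquiv.symm_apply_eq]
    change _ = α.1 _
    rw [α.2, he]⟩
  exact ⟨⟨α, β, Subtype.ext (AddMonoidHom.ext he), Subtype.ext (AddMonoidHom.ext he')⟩, rfl⟩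

theorem IsSimpleGModule.nontrivial_gEnd (h : IsSimpleGModule G A) : Nontrivial (gEnd G A) := by
  have := h.1
  obtain ⟨a, ha⟩ := exists_ne (0 : A)
  exact ⟨1, 0, fun h0 => ha (congrArg (fun α : gEnd G A => α.1 a) h0)⟩

end Schur

/-! ### Kernels of indecomposable covers -/

namespace ProfiniteCover

variable {G : ProfiniteGrp.{u}}

theorem mem_ker {η : ProfiniteCover G} {x : η.dom} : x ∈ η.ker ↔ η.map x = 1 := Iff.rfl

/-- The factorization of a cover through the quotient by `N ⊓ ker`, where `N` is open normal. -/
theorem IsIndecomposable.ker_inf_eq_bot_or_ker_le {η : ProfiniteCover G} (h : η.IsIndecomposable)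
    (N : Subgroup η.dom) [N.Normal] (hN : IsOpen (N : Set η.dom)) :
    η.ker ⊓ N = ⊥ ∨ η.ker ≤ N := by
  have : DiscreteTopology (η.dom ⧸ N) := QuotientGroup.discreteTopology hN
  let ψ' : η.dom →* G × (η.dom ⧸ N) := η.map.toMonoidHom.prod (QuotientGroup.mk' N)
  have hψ' : Continuous ψ' := η.map.continuous_toFun.prodMk QuotientGroup.continuous_mk
  have : CompactSpace ψ'.range := by
    refine isCompact_iff_compactSpace.mp ?_
    rw [MonoidHom.coe_range]
    exact isCompact_range hψ'
  let ψ : η.dom →ₜ* ProfiniteGrp.of ψ'.range :=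
    { ψ'.rangeRestrict with
      continuous_toFun := hψ'.subtype_mk _ }
  let ρ : ProfiniteGrp.of ψ'.range →ₜ* G :=
    { toFun := fun x => x.1.1
      map_one' := rfl
      map_mul' := fun _ _ => rfl
      continuous_toFun := continuous_fst.comp continuous_subtype_val }
  have hρψ : ∀ x, ρ (ψ x) = η.map x := fun _ => rfl
  have hψs : Function.Surjective ψ := ψ'.rangeRestrict_surjective
  have hρs : Function.Surjective ρ := fun g => by
    obtain ⟨x, rfl⟩ := η.surj g
    exact ⟨ψ x, rfl⟩
  rcases h.2 _ ψ ρ hψs hρs hρψ with hb | hb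
  · refine Or.inl ((Subgroup.eq_bot_iff_forall _).mpr fun x hx => hb.1 (Subtype.ext ?_))
    refine Prod.ext (mem_ker.mp hx.1 |>.trans (map_one η.map).symm) ?_
    exact ((QuotientGroup.eq_one_iff x).mpr hx.2).trans rfl
  · refine Or.inr fun x hx => ?_
    have h1 : ψ x = ψ 1 := hb.1 (by rw [hρψ, hρψ, mem_ker.mp hx, map_one])
    have h2 : (QuotientGroup.mk x : η.dom ⧸ N) = QuotientGroup.mk 1 :=
      congrArg (fun y => y.1.2) h1
    exact (QuotientGroup.eq_one_iff x).mp h2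

theorem IsIndecomposable.exists_ker_ne_one {η : ProfiniteCover G} (h : η.IsIndecomposable) :
    ∃ k ∈ η.ker, k ≠ 1 := by
  by_contra! hc
  exact h.1 ⟨(injective_iff_map_eq_one η.map).mpr hc, η.surj⟩

/-- An open normal subgroup that misses one nontrivial element of the kernel cannot contain the
kernel, so it meets it trivially. Discreteness and finiteness of the kernel follow. -/
theorem IsIndecomposable.exists_openNormalSubgroup {η : ProfiniteCover G}
    (h : η.IsIndecomposable) : ∃ U : OpenNormalSubgroup η.dom, η.ker ⊓ U.toSubgroup = ⊥ := by
  obtain ⟨k, hk, hk1⟩ := h.exists_ker_ne_one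
  obtain ⟨U, hU⟩ := ProfiniteGrp.exist_openNormalSubgroup_sub_open_nhds_of_one
    (isOpen_compl_singleton (x := k)) (by simpa using hk1.symm)
  exact ⟨U, (h.ker_inf_eq_bot_or_ker_le U.toSubgroup U.isOpen').resolve_right
    fun hle => hU (hle hk) rfl⟩

theorem IsIndecomposable.discreteTopology_ker {η : ProfiniteCover G} (h : η.IsIndecomposable) :
    DiscreteTopology η.ker := by
  obtain ⟨U, hU⟩ := h.exists_openNormalSubgroup
  refine discreteTopology_of_isOpen_singleton_one ?_
  have : ({1} : Set η.ker) = Subtype.val ⁻¹' (U.toSubgroup : Set η.dom) := by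
    ext x
    constructor
    · rintro rfl
      exact one_mem U.toSubgroup
    · intro hx
      have : (x : η.dom) ∈ η.ker ⊓ U.toSubgroup := ⟨x.2, hx⟩
      rw [hU] at this
      exact Subtype.ext this
  rw [this]
  exact U.isOpen'.preimage continuous_subtype_val

theorem isClosed_ker (η : ProfiniteCover G) : IsClosed (η.ker : Set η.dom) :=
  isClosed_singleton.preimage η.map.continuous_toFun

theorem IsIndecomposable.finite_ker {η : ProfiniteCover G} (h : η.IsIndecomposable) :
    Finite η.ker := by
  have := h.discreteTopology_ker
  have : CompactSpace η.ker := isCompact_iff_compactSpace.mp η.isClosed_ker.isCompact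
  exact finite_of_compact_of_discrete

/-- The kernel of an indecomposable cover is a minimal normal subgroup. -/
theorem IsIndecomposable.eq_bot_or_eq_ker {η : ProfiniteCover G} (h : η.IsIndecomposable)
    (N : Subgroup η.dom) [N.Normal] (hN : N ≤ η.ker) : N = ⊥ ∨ N = η.ker := by
  obtain ⟨U, hU⟩ := h.exists_openNormalSubgroup
  -- `N` need not be open, but `N ⊔ U` is; since `U` meets the kernel trivially, `N` is recovered as
  -- its intersection with the kernel.
  have hopen : IsOpen ((N ⊔ U.toSubgroup : Subgroup η.dom) : Set η.dom) :=
    Subgroup.isOpen_mono le_sup_right U.isOpen'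
  rcases h.ker_inf_eq_bot_or_ker_le (N ⊔ U.toSubgroup) hopen with h1 | h1
  · exact Or.inl (le_bot_iff.mp (h1 ▸ le_inf hN le_sup_left))
  · refine Or.inr (le_antisymm hN fun x hx => ?_)
    obtain ⟨n, hn, v, hv, rfl⟩ := Subgroup.mem_sup_of_normal_left.mp (h1 hx)
    have : v ∈ η.ker ⊓ U.toSubgroup := ⟨(Subgroup.mul_mem_cancel_left _ (hN hn)).mp hx, hv⟩
    rw [hU, Subgroup.mem_bot] at this
    rwa [this, mul_one]

/-- A surjective homomorphism over `G` maps a normal subgroup in the kernel that it does not kill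
onto the kernel. -/
theorem IsIndecomposable.exists_mem_map_eq {η π : ProfiniteCover G} (h : π.IsIndecomposable)
    (θ : η.dom →ₜ* π.dom) (hs : Function.Surjective θ) (hθ : ∀ x, π.map (θ x) = η.map x)
    (M : Subgroup η.dom) [hM : M.Normal] (hMk : M ≤ η.ker) (hne : ∃ m ∈ M, θ m ≠ 1) {k : π.dom}
    (hk : k ∈ π.ker) : ∃ m ∈ M, θ m = k := by
  have hn : (M.map θ.toMonoidHom).Normal := hM.map _ hs
  have : M.map θ.toMonoidHom = π.ker := by
    refine (h.eq_bot_or_eq_ker _ ?_).resolve_left fun hb => ?_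
    · rintro _ ⟨m, hm, rfl⟩
      exact (hθ m).trans (hMk hm)
    · obtain ⟨m, hm, hm1⟩ := hne
      exact hm1 (Subgroup.mem_bot.mp (hb ▸ ⟨m, hm, rfl⟩ : θ m ∈ (⊥ : Subgroup π.dom)))
  rw [← this] at hk
  exact hk

end ProfiniteCover

/-! ### Functoriality of `Hom_G(ker, A)` and of its map to `H²` -/

namespace ProfiniteCover

variable {G : ProfiniteGrp.{u}}

section DualMap

variable {η π ρ : ProfiniteCover G}

/-- The restriction to the kernels of a homomorphism over `G`. -/
def kerMap (θ : η.dom →ₜ* π.dom) (hθ : ∀ x, π.map (θ x) = η.map x) (k : η.ker) : π.ker :=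
  ⟨θ k, (hθ k).trans k.2⟩

theorem continuous_kerMap (θ : η.dom →ₜ* π.dom) (hθ : ∀ x, π.map (θ x) = η.map x) :
    Continuous (kerMap θ hθ) :=
  (θ.continuous_toFun.comp continuous_subtype_val).subtype_mk _

variable (A : Type u) [AddCommGroup A] [TopologicalSpace A] [DiscreteTopology A]
  [DistribMulAction G A]

/-- The map `Hom_G(ker π, A) → Hom_G(ker η, A)` induced by a homomorphism `η → π` over `G`. -/
def dualMap (θ : η.dom →ₜ* π.dom) (hθ : ∀ x, π.map (θ x) = η.map x) :
    kerDual π A →ₗ[gEnd G A] kerDual η A where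
  toFun φ := ⟨fun k => φ.1 (kerMap θ hθ k), φ.2.1.comp (continuous_kerMap θ hθ), fun k k' => by
    rw [← φ.2.2.1]
    exact congrArg φ.1 (Subtype.ext (map_mul θ _ _)), fun h k => by
    rw [← hθ h, ← φ.2.2.2]
    refine congrArg φ.1 (Subtype.ext ?_)
    change θ (h * k * h⁻¹) = θ h * θ k * (θ h)⁻¹
    rw [map_mul, map_mul, map_inv]⟩
  map_add' _ _ := rfl
  map_smul' _ _ := rfl

variable {A}

theorem dualMap_apply (θ : η.dom →ₜ* π.dom) (hθ : ∀ x, π.map (θ x) = η.map x) (φ : kerDual π A)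
    (k : η.ker) : (dualMap A θ hθ φ).1 k = φ.1 (kerMap θ hθ k) := rfl

theorem kerDual_map_one (φ : kerDual η A) : φ.1 1 = 0 := by
  have h := φ.2.2.1 1 1
  rwa [mul_one, right_eq_add] at h

theorem kerDual_map_inv (φ : kerDual η A) (k : η.ker) : φ.1 k⁻¹ = -φ.1 k := by
  rw [eq_neg_iff_add_eq_zero, ← φ.2.2.1, inv_mul_cancel, kerDual_map_one]

theorem kerDual_ext {φ φ' : kerDual η A} (h : ∀ k, φ.1 k = φ'.1 k) : φ = φ' :=
  Subtype.ext (funext h)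

theorem dualMap_injective (θ : η.dom →ₜ* π.dom) (hθ : ∀ x, π.map (θ x) = η.map x)
    (hs : Function.Surjective θ) : Function.Injective (dualMap A θ hθ) := by
  intro φ φ' h
  refine kerDual_ext fun k => ?_
  obtain ⟨x, hx⟩ := hs k
  have hxk : x ∈ η.ker := by rw [mem_ker, ← hθ, hx]; exact k.2
  have := congrFun (congrArg Subtype.val h) ⟨x, hxk⟩
  have hk : kerMap θ hθ ⟨x, hxk⟩ = k := Subtype.ext hx
  rwa [dualMap_apply, dualMap_apply, hk] at this

/-- `θ` carries a continuous section of `η` to one of `π`, and its factor set to the factor set. As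
the class does not depend on the section, both sides can be computed from these two sections, where
the cocycles coincide. -/
theorem dualToH2_dualMap (θ : η.dom →ₜ* π.dom) (hθ : ∀ x, π.map (θ x) = η.map x)
    (hη : η.HasContinuousSection) (hπ : π.HasContinuousSection) (φ : kerDual π A) :
    dualToH2 (A := A) hη (dualMap A θ hθ φ) = dualToH2 (A := A) hπ φ := by
  have hc : Continuous fun g => θ (hη.choose g) :=
    θ.continuous_toFun.comp hη.choose_spec.1
  have hu : ∀ g, π.map (θ (hη.choose g)) = g := fun g => by rw [hθ, hη.choose_spec.2]
  have h1 : dualToH2 (A := A) hπ = dualToH2OfSection _ hc hu :=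
    dualToH2OfSection_eq _ _ _ _ _ _
  rw [h1]
  refine congrArg (twoCoboundaries G A).mkQ (Subtype.ext ?_)
  funext σ τ
  refine congrArg φ.1 (Subtype.ext ?_)
  change θ (_ * _ * _⁻¹) = _
  rw [map_mul, map_mul, map_inv]
  rfl

theorem range_dualToH2_le (θ : η.dom →ₜ* π.dom) (hθ : ∀ x, π.map (θ x) = η.map x)
    (hη : η.HasContinuousSection) (hπ : π.HasContinuousSection) :
    LinearMap.range (dualToH2 (A := A) hπ) ≤ LinearMap.range (dualToH2 (A := A) hη) := by
  rintro _ ⟨φ, rfl⟩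
  exact ⟨dualMap A θ hθ φ, dualToH2_dualMap θ hθ hη hπ φ⟩

theorem rank_ker_dualToH2_le (θ : η.dom →ₜ* π.dom) (hθ : ∀ x, π.map (θ x) = η.map x)
    (hs : Function.Surjective θ) (hη : η.HasContinuousSection) (hπ : π.HasContinuousSection) :
    Module.rank (gEnd G A) (LinearMap.ker (dualToH2 (A := A) hπ)) ≤
      Module.rank (gEnd G A) (LinearMap.ker (dualToH2 (A := A) hη)) := by
  let f : LinearMap.ker (dualToH2 (A := A) hπ) →ₗ[gEnd G A] LinearMap.ker (dualToH2 (A := A) hη) :=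
    (dualMap A θ hθ).restrict fun φ hφ => by
      rw [LinearMap.mem_ker, dualToH2_dualMap θ hθ hη hπ]
      exact hφ
  refine LinearMap.rank_le_of_injective f fun x y hxy => Subtype.ext ?_
  exact dualMap_injective θ hθ hs (congrArg Subtype.val hxy)

/-- If `φ` vanishes on the elements of `M` killed by `θ`, and `θ` maps `M` onto the kernel of `π`,
then `φ` agrees on `M` with a homomorphism that factors through `θ`. -/
theorem exists_kerDual_eq_on (hπ : π.IsIndecomposable) (θ : η.dom →ₜ* π.dom)
    (hs : Function.Surjective θ) (hθ : ∀ x, π.map (θ x) = η.map x) (M : Subgroup η.dom)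
    [hM : M.Normal] (hMk : M ≤ η.ker) (hne : ∃ m ∈ M, θ m ≠ 1) (φ : kerDual η A)
    (hφ : ∀ k : η.ker, k.1 ∈ M → θ k = 1 → φ.1 k = 0) :
    ∃ e : kerDual π A, ∀ k : η.ker, k.1 ∈ M → φ.1 k = (dualMap A θ hθ e).1 k := by
  have hsur : ∀ k : π.ker, ∃ m : η.ker, m.1 ∈ M ∧ kerMap θ hθ m = k := fun k => by
    obtain ⟨m, hm, hmk⟩ := hπ.exists_mem_map_eq θ hs hθ M hMk hne k.2
    exact ⟨⟨m, hMk hm⟩, hm, Subtype.ext hmk⟩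
  choose s hsM hs' using hsur
  have hmul : ∀ k k', kerMap θ hθ (k * k') = kerMap θ hθ k * kerMap θ hθ k' := fun k k' =>
    Subtype.ext (map_mul θ _ _)
  -- On `M` the value of `φ` depends only on the image under `θ`, so `e` may be defined through
  -- arbitrary preimages in `M`.
  have key : ∀ a b : η.ker, a.1 ∈ M → b.1 ∈ M → kerMap θ hθ a = kerMap θ hθ b →
      φ.1 a = φ.1 b := by
    intro a b ha hb hab
    have h1 : φ.1 (a * b⁻¹) = 0 := hφ _ (mul_mem ha (inv_mem hb)) (by
      have : θ a = θ b := congrArg Subtype.val hab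
      change θ (a.1 * b.1⁻¹) = 1
      rw [map_mul, map_inv, this, mul_inv_cancel])
    rw [φ.2.2.1, kerDual_map_inv] at h1
    exact add_neg_eq_zero.mp h1
  have := hπ.discreteTopology_ker
  refine ⟨⟨fun k => φ.1 (s k), continuous_of_discreteTopology, fun k k' => ?_, fun h k => ?_⟩,
    fun k hk => ?_⟩
  · rw [← φ.2.2.1]
    exact key _ _ (hsM _) (mul_mem (hsM k) (hsM k')) (by rw [hmul, hs', hs', hs'])
  · obtain ⟨h, rfl⟩ := hs h
    rw [hθ, ← φ.2.2.2]
    refine key _ _ (hsM _) (hM.conj_mem _ (hsM k) _) ?_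
    rw [hs']
    nth_rw 1 [← hs' k]
    refine Subtype.ext ?_
    change θ h * θ (s k) * (θ h)⁻¹ = θ (h * s k * h⁻¹)
    rw [map_mul, map_mul, map_inv]
  · exact key _ _ hk (hsM _) (hs' _).symm

end DualMap

/-! ### From equal cohomology classes to homomorphisms over `G` -/

section Extension

variable {η π : ProfiniteCover G} {A : Type u} [AddCommGroup A] [TopologicalSpace A]
  [DiscreteTopology A] [DistribMulAction G A]

theorem exists_cochain_of_dualToH2_eq (hη : η.HasContinuousSection) (hπ : π.HasContinuousSection)
    (φ : kerDual η A) (e : kerDual π A) (h : dualToH2 (A := A) hη φ = dualToH2 (A := A) hπ e) :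
    ∃ (v : G → η.dom) (_ : Continuous v) (hv : ∀ g, η.map (v g) = g)
      (w : G → π.dom) (_ : Continuous w) (hw : ∀ g, π.map (w g) = g)
      (c : G → A) (_ : Continuous c), ∀ σ τ,
        φ.1 (factorSet v hv σ τ) - e.1 (factorSet w hw σ τ) = σ • c τ - c (σ * τ) + c σ := by
  obtain ⟨c, hc, hc'⟩ := (Submodule.Quotient.eq _).mp h
  exact ⟨_, hη.choose_spec.1, hη.choose_spec.2, _, hπ.choose_spec.1, hπ.choose_spec.2, c, hc, hc'⟩

/-- If the kernel of `π` is isomorphic to `A` via `e` and `φ : ker η → A` maps the class of `η` to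
that of `π`, then `φ` extends to a homomorphism `η → π` over `G`. -/
theorem exists_dualMap_eq (hη : η.HasContinuousSection) (hπ : π.HasContinuousSection)
    [DiscreteTopology π.ker] (φ : kerDual η A) (e : kerDual π A) (he : Function.Bijective e.1)
    (h : dualToH2 (A := A) hη φ = dualToH2 (A := A) hπ e) :
    ∃ (θ : η.dom →ₜ* π.dom) (hθ : ∀ x, π.map (θ x) = η.map x), dualMap A θ hθ e = φ := by
  obtain ⟨v, hvc, hv, w, hwc, hw, c, hc, H⟩ := exists_cochain_of_dualToH2_eq hη hπ φ e h
  let E : π.ker ≃ A := Equiv.ofBijective e.1 he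
  have hE : ∀ a, e.1 (E.symm a) = a := E.apply_symm_apply
  -- Each `x` is `q x * v (η.map x)`. The map applies `φ` to the first factor and replaces `v` by
  -- `w`; the shift by `c` absorbs the difference of the two factor sets and makes it
  -- multiplicative.
  let q : η.dom → η.ker := fun x => ⟨x * (v (η.map x))⁻¹, by
    rw [mem_ker, map_mul, map_inv, hv, mul_inv_cancel]⟩
  have hmapc : Continuous η.map := η.map.continuous_toFun
  have hq : Continuous q := (continuous_id.mul (hvc.comp hmapc).inv).subtype_mk _
  let f : η.dom → π.dom := fun x => E.symm (φ.1 (q x) + c (η.map x)) * w (η.map x)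
  have hf : Continuous f := by
    refine Continuous.mul (continuous_subtype_val.comp ?_) (hwc.comp hmapc)
    exact (continuous_of_discreteTopology (f := E.symm)).comp
      ((φ.2.1.comp hq).add (hc.comp hmapc))
  have hfmap : ∀ x, π.map (f x) = η.map x := fun x => by
    have : π.map (E.symm (φ.1 (q x) + c (η.map x))) = 1 := (E.symm _).2
    rw [map_mul, this, hw, one_mul]
  have hqmul : ∀ x y, φ.1 (q (x * y)) = φ.1 (q x) + η.map x • φ.1 (q y) +
      φ.1 (factorSet v hv (η.map x) (η.map y)) := fun x y => by
    have : q (x * y) = q x * MulAut.conjNormal (v (η.map x)) (q y) *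
        factorSet v hv (η.map x) (η.map y) := by
      refine Subtype.ext ?_
      simp only [q, Subgroup.coe_mul, MulAut.conjNormal_apply, factorSet, map_mul]
      group
    rw [this, φ.2.2.1, φ.2.2.1, φ.2.2.2, hv]
  have hfmul : ∀ x y, f (x * y) = f x * f y := fun x y => by
    set a := φ.1 (q x) + c (η.map x) with ha
    set b := φ.1 (q y) + c (η.map y) with hb
    have h1 : E.symm (φ.1 (q (x * y)) + c (η.map (x * y))) =
        E.symm a * MulAut.conjNormal (w (η.map x)) (E.symm b) *
          factorSet w hw (η.map x) (η.map y) := by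
      apply he.1
      rw [hE, e.2.2.1, e.2.2.1, e.2.2.2, hw, hE, hE, hqmul, map_mul, ha, hb,
        eq_add_of_sub_eq (H (η.map x) (η.map y)), smul_add]
      abel
    change (E.symm (φ.1 (q (x * y)) + c (η.map (x * y))) : π.dom) * w (η.map (x * y)) =
      E.symm a * w (η.map x) * (E.symm b * w (η.map y))
    rw [h1]
    simp only [Subgroup.coe_mul, MulAut.conjNormal_apply, factorSet, map_mul]
    group
  let θ : η.dom →ₜ* π.dom :=
    { MonoidHom.mk' f hfmul with continuous_toFun := hf }
  have hθ : ∀ x, π.map (θ x) = η.map x := hfmap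
  refine ⟨θ, hθ, kerDual_ext fun k => ?_⟩
  have hk : η.map k = 1 := k.2
  -- The sections are not normalized, so `v 1` and `w 1` may be nontrivial. The cochain identity at
  -- `(1, 1)` determines `c 1`, and the corrections cancel.
  let v1 : η.ker := ⟨v 1, hv 1⟩
  let w1 : π.ker := ⟨w 1, hw 1⟩
  have hH : φ.1 v1 - e.1 w1 = c 1 := by
    have := H 1 1
    have h1 : factorSet v hv 1 1 = v1 := Subtype.ext (by simp [factorSet, v1])
    have h2 : factorSet w hw 1 1 = w1 := Subtype.ext (by simp [factorSet, w1])
    rw [h1, h2, one_smul, mul_one, sub_self, zero_add] at this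
    exact this
  have hθk : kerMap θ hθ k = E.symm (φ.1 (k * v1⁻¹) + c 1) * w1 := by
    refine Subtype.ext ?_
    have : q k = k * v1⁻¹ := Subtype.ext (by simp only [q, hk]; rfl)
    change ((E.symm (φ.1 (q k) + c (η.map k)) : π.ker) : π.dom) * w (η.map k) = _
    rw [this, hk]
    rfl
  rw [dualMap_apply, hθk, e.2.2.1, hE, φ.2.2.1, kerDual_map_inv, ← hH]
  abel

end Extension

/-! ### Common kernels of finitely many homomorphisms -/

section Family

variable {η : ProfiniteCover G} {J : Type*} {π : J → ProfiniteCover G}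

/-- The elements of the kernel of `η` killed by the homomorphisms `θ j`, `j ∈ F`. -/
def commonKer (θ : ∀ j, η.dom →ₜ* (π j).dom) (F : Set J) : Subgroup η.dom where
  carrier := {x | x ∈ η.ker ∧ ∀ j ∈ F, θ j x = 1}
  mul_mem' {x y} hx hy := ⟨mul_mem hx.1 hy.1, fun j hj => by
    rw [map_mul, hx.2 j hj, hy.2 j hj, one_mul]⟩
  one_mem' := ⟨one_mem _, fun j _ => map_one _⟩
  inv_mem' {x} hx := ⟨inv_mem hx.1, fun j hj => by rw [map_inv, hx.2 j hj, inv_one]⟩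

instance normal_commonKer (θ : ∀ j, η.dom →ₜ* (π j).dom) (F : Set J) :
    (commonKer θ F).Normal where
  conj_mem x hx g := ⟨η.map.toMonoidHom.normal_ker.conj_mem x hx.1 g, fun j hj => by
    rw [map_mul, map_mul, hx.2 j hj, mul_one, map_inv, mul_inv_cancel]⟩

variable (θ : ∀ j, η.dom →ₜ* (π j).dom) (hπ : ∀ j, (π j).IsIndecomposable)
  (hs : ∀ j, Function.Surjective (θ j)) (hθ : ∀ j x, (π j).map (θ j x) = η.map x)

-- Induction on `F`. If `θ i` is trivial on the common kernel of the earlier maps, it can be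
-- dropped. Otherwise it maps that common kernel onto the kernel of `π i`, so `φ` agrees there with
-- a homomorphism through `θ i`, and the difference falls under the induction hypothesis.
include hπ hs in
theorem mem_iSup_range_dualMap {A : Type u} [AddCommGroup A] [TopologicalSpace A]
    [DiscreteTopology A] [DistribMulAction G A] (F : Finset J) (φ : kerDual η A)
    (hφ : ∀ k : η.ker, k.1 ∈ commonKer θ F → φ.1 k = 0) :
    φ ∈ ⨆ j ∈ F, LinearMap.range (dualMap A (θ j) (hθ j)) := by
  classical
  induction F using Finset.induction_on generalizing φ with
  | empty =>
    have : φ = 0 := kerDual_ext fun k => hφ k ⟨k.2, by simp⟩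
    rw [this]
    exact zero_mem _
  | insert i F hi ih =>
    rw [Finset.iSup_insert]
    by_cases hne : ∃ m ∈ commonKer θ F, θ i m ≠ 1
    · obtain ⟨e, he⟩ := exists_kerDual_eq_on (hπ i) (θ i) (hs i) (hθ i) (commonKer θ F)
        (fun x hx => hx.1) hne φ fun k hk hk1 => hφ k ⟨k.2, by
          intro j hj
          rcases Finset.mem_insert.mp (Finset.mem_coe.mp hj) with rfl | hj
          · exact hk1
          · exact hk.2 j hj⟩
      have h1 := ih (φ - dualMap A (θ i) (hθ i) e) fun k hk => by
        change φ.1 k - (dualMap A (θ i) (hθ i) e).1 k = 0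
        rw [he k hk, sub_self]
      rw [← sub_add_cancel φ (dualMap A (θ i) (hθ i) e)]
      exact add_mem (Submodule.mem_sup_right h1) (Submodule.mem_sup_left ⟨e, rfl⟩)
    · push Not at hne
      refine Submodule.mem_sup_right (ih φ fun k hk => hφ k ⟨k.2, ?_⟩)
      intro j hj
      rcases Finset.mem_insert.mp (Finset.mem_coe.mp hj) with rfl | hj
      · exact hne k hk
      · exact hk.2 j hj

/-- The kernel of an indecomposable quotient with non-abelian kernel is prime. -/
theorem exists_mem_forall_map_eq_one {ζ : ProfiniteCover G} (hζ : ζ.IsIndecomposable)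
    (hna : ¬ ζ.HasAbelianKernel) (ψ : η.dom →ₜ* ζ.dom) (hψs : Function.Surjective ψ)
    (hψ : ∀ x, ζ.map (ψ x) = η.map x) (F : Finset J) (hF : ∀ x ∈ commonKer θ F, ψ x = 1) :
    ∃ j ∈ F, ∀ x ∈ η.ker, θ j x = 1 → ψ x = 1 := by
  classical
  induction F using Finset.induction_on with
  | empty =>
    exfalso
    obtain ⟨k, hk, hk1⟩ := hζ.exists_ker_ne_one
    obtain ⟨x, rfl⟩ := hψs k
    exact hk1 (hF x ⟨by rwa [mem_ker, ← hψ], by simp⟩)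
  | insert i F hi ih =>
    by_cases h1 : ∀ x ∈ commonKer θ F, ψ x = 1
    · obtain ⟨j, hj, h⟩ := ih h1
      exact ⟨j, Finset.mem_insert_of_mem hj, h⟩
    by_cases h2 : ∀ x ∈ commonKer θ {i}, ψ x = 1
    · exact ⟨i, Finset.mem_insert_self i F, fun x hx hx1 => h2 x ⟨hx, by simpa using hx1⟩⟩
    exfalso
    push Not at h1 h2
    -- By minimality `ψ` maps both common kernels onto the kernel of `ζ`. Commutators between them
    -- lie in their intersection, which `ψ` kills, so the kernel of `ζ` would be abelian.
    refine hna fun k hk l hl => ?_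
    obtain ⟨m, hm, rfl⟩ := hζ.exists_mem_map_eq ψ hψs hψ (commonKer θ F) (fun x hx => hx.1) h1 hk
    obtain ⟨n, hn, rfl⟩ := hζ.exists_mem_map_eq ψ hψs hψ (commonKer θ {i}) (fun x hx => hx.1) h2 hl
    have hcomm : m * n * m⁻¹ * n⁻¹ ∈ commonKer θ (insert i F : Finset J) := by
      have hmn : m * n * m⁻¹ * n⁻¹ ∈ commonKer θ F := by
        rw [mul_assoc, mul_assoc]
        refine mul_mem hm ?_
        rw [← mul_assoc]
        exact (normal_commonKer θ F).conj_mem _ (inv_mem hm) n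
      have hmn' : m * n * m⁻¹ * n⁻¹ ∈ commonKer θ {i} :=
        mul_mem ((normal_commonKer θ {i}).conj_mem _ hn m) (inv_mem hn)
      refine ⟨hmn.1, fun j hj => ?_⟩
      rcases Finset.mem_insert.mp (Finset.mem_coe.mp hj) with rfl | hj
      · exact hmn'.2 j rfl
      · exact hmn.2 j hj
    have := hF _ hcomm
    rw [map_mul, map_mul, map_mul, map_inv, map_inv, mul_inv_eq_one, mul_inv_eq_iff_eq_mul] at this
    exact this

end Family

end ProfiniteCover

namespace ProfiniteCover

variable {G : ProfiniteGrp.{u}}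

/-! ### Fiber products and isomorphisms over `G` -/

section FiberProduct

variable {I : Type u} (η : I → ProfiniteCover G)

/-- The projection of the fiber product to a factor. -/
def proj (i : I) : (fiberProduct η).dom →ₜ* (η i).dom where
  toFun x := x.1.2 i
  map_one' := rfl
  map_mul' _ _ := rfl
  continuous_toFun := (continuous_apply i).comp (continuous_snd.comp continuous_subtype_val)

theorem map_proj (i : I) (x : (fiberProduct η).dom) :
    (η i).map (proj η i x) = (fiberProduct η).map x := x.2 i

variable {η}

theorem fiberProduct_ext {x y : (fiberProduct η).dom}
    (h : (fiberProduct η).map x = (fiberProduct η).map y) (h' : ∀ i, proj η i x = proj η i y) :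
    x = y := Subtype.ext (Prod.ext h (funext h'))

/-- The homomorphism to the fiber product with given components. -/
def lift {ρ : ProfiniteCover G} (θ : ∀ i, ρ.dom →ₜ* (η i).dom)
    (hθ : ∀ i x, (η i).map (θ i x) = ρ.map x) : ρ.dom →ₜ* (fiberProduct η).dom where
  toFun x := ⟨(ρ.map x, fun i => θ i x), fun i => hθ i x⟩
  map_one' := Subtype.ext (Prod.ext (map_one ρ.map) (funext fun i => map_one (θ i)))
  map_mul' x y := Subtype.ext (Prod.ext (map_mul ρ.map x y) (funext fun i => map_mul (θ i) x y))
  continuous_toFun := (ρ.map.continuous_toFun.prodMk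
    (continuous_pi fun i => (θ i).continuous_toFun)).subtype_mk _

theorem map_lift {ρ : ProfiniteCover G} (θ : ∀ i, ρ.dom →ₜ* (η i).dom)
    (hθ : ∀ i x, (η i).map (θ i x) = ρ.map x) (x : ρ.dom) :
    (fiberProduct η).map (lift θ hθ x) = ρ.map x := rfl

theorem proj_lift {ρ : ProfiniteCover G} (θ : ∀ i, ρ.dom →ₜ* (η i).dom)
    (hθ : ∀ i x, (η i).map (θ i x) = ρ.map x) (i : I) (x : ρ.dom) :
    proj η i (lift θ hθ x) = θ i x := rfl

theorem exists_fiberProduct (g : G) (y : ∀ i, (η i).dom) (h : ∀ i, (η i).map (y i) = g) :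
    ∃ x : (fiberProduct η).dom, (fiberProduct η).map x = g ∧ ∀ i, proj η i x = y i :=
  ⟨⟨(g, y), h⟩, rfl, fun _ => rfl⟩

/-- There are elements of the kernel of the fiber product with a single nontrivial coordinate,
prescribed in the corresponding kernel. -/
theorem exists_proj_eq_of_mem_ker (i : I) {k : (η i).dom} (hk : k ∈ (η i).ker) :
    ∃ x ∈ (fiberProduct η).ker, proj η i x = k ∧ ∀ j, j ≠ i → proj η j x = 1 := by
  classical
  obtain ⟨x, hx, hx'⟩ := exists_fiberProduct (η := η) 1 (Function.update (fun _ => 1) i k)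
    (fun j => by
      by_cases h : j = i
      · subst h
        simpa using hk
      · simp [h])
  exact ⟨x, hx, by simp [hx'], fun j hj => by simp [hx', hj]⟩

theorem proj_surjective (i : I) : Function.Surjective (proj η i) := by
  intro h
  obtain ⟨x, hx⟩ := (fiberProduct η).surj ((η i).map h)
  have hk : h * (proj η i x)⁻¹ ∈ (η i).ker := by
    rw [mem_ker, map_mul, map_inv, map_proj, hx, mul_inv_cancel]
  obtain ⟨y, -, hy, -⟩ := exists_proj_eq_of_mem_ker i hk
  exact ⟨y * x, by rw [map_mul, hy, inv_mul_cancel_right]⟩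

/-- A neighborhood of `1` contains the elements of the kernel for which finitely many coordinates
are trivial. -/
theorem exists_finset_commonKer_subset {W : Set (fiberProduct η).dom} (hW : IsOpen W)
    (h1 : 1 ∈ W) : ∃ F : Finset I, ∀ x ∈ commonKer (proj η) F, x ∈ W := by
  obtain ⟨W', hW', rfl⟩ := isOpen_induced_iff.mp hW
  obtain ⟨U, V, hU, hV, hU1, hV1, hUV⟩ := isOpen_prod_iff.mp hW' 1 1 h1
  obtain ⟨F, v, hv, hvV⟩ := isOpen_pi_iff.mp hV _ hV1
  refine ⟨F, fun x hx => hUV ⟨?_, hvV fun i hi => ?_⟩⟩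
  · have : x.1.1 = 1 := hx.1
    rwa [this]
  · have : x.1.2 i = 1 := hx.2 i hi
    rw [this]
    exact (hv i hi).2

/-- A criterion for the surjectivity of a homomorphism to a fiber product. -/
theorem lift_surjective {ρ : ProfiniteCover G} (hη : ∀ i, (η i).IsIndecomposable)
    (θ : ∀ i, ρ.dom →ₜ* (η i).dom) (hθ : ∀ i x, (η i).map (θ i x) = ρ.map x)
    (hs : ∀ i, Function.Surjective (θ i))
    (hind : ∀ (F : Finset I) (i : I), i ∉ F → ∃ x ∈ commonKer θ F, θ i x ≠ 1) :
    Function.Surjective (lift θ hθ) := by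
  classical
  -- Finitely many coordinates are matched one at a time: an element of the common kernel of the
  -- earlier components corrects the next one without disturbing them.
  have hfin : ∀ (y : (fiberProduct η).dom) (F : Finset I),
      ∃ x, ρ.map x = (fiberProduct η).map y ∧ ∀ i ∈ F, θ i x = proj η i y := by
    intro y F
    induction F using Finset.induction_on with
    | empty =>
      obtain ⟨x, hx⟩ := ρ.surj ((fiberProduct η).map y)
      exact ⟨x, hx, by simp⟩
    | insert i F hi ih =>
      obtain ⟨x, hx, hxF⟩ := ih
      have hk : proj η i y * (θ i x)⁻¹ ∈ (η i).ker := by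
        rw [mem_ker, map_mul, map_inv, map_proj, hθ, hx, mul_inv_cancel]
      obtain ⟨m, hm, hmk⟩ := (hη i).exists_mem_map_eq (θ i) (hs i) (hθ i) (commonKer θ F)
        (fun z hz => hz.1) (hind F i hi) hk
      refine ⟨m * x, ?_, fun j hj => ?_⟩
      · rw [map_mul, mem_ker.mp hm.1, one_mul, hx]
      · rcases Finset.mem_insert.mp hj with rfl | hj
        · rw [map_mul, hmk, inv_mul_cancel_right]
        · rw [map_mul, hm.2 j hj, one_mul, hxF j hj]
  -- The finite approximations make the image dense, and it is closed by compactness.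
  have hclosed : IsClosed (Set.range (lift θ hθ)) :=
    (isCompact_range (lift θ hθ).continuous_toFun).isClosed
  intro y
  by_contra hy
  have hy' : y ∈ (Set.range (lift θ hθ))ᶜ := hy
  obtain ⟨F, hF⟩ := exists_finset_commonKer_subset
    (hclosed.isOpen_compl.preimage (continuous_const_mul y)) (by simpa using hy)
  obtain ⟨x, hx, hxF⟩ := hfin y F
  refine hF (y⁻¹ * lift θ hθ x) ⟨?_, fun i hi => ?_⟩ ?_
  · rw [mem_ker, map_mul, map_inv, map_lift, hx, inv_mul_cancel]
  · rw [map_mul, map_inv, proj_lift, hxF i hi, inv_mul_cancel]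
  · exact ⟨x, (mul_inv_cancel_left y _).symm⟩

theorem IsIso.of_bijective {η π : ProfiniteCover G} (θ : η.dom →ₜ* π.dom)
    (hθ : ∀ x, π.map (θ x) = η.map x) (hb : Function.Bijective θ) : η.IsIso π := by
  let e : η.dom ≃ₜ π.dom :=
    θ.continuous_toFun.homeoOfEquivCompactToT2 (f := Equiv.ofBijective θ hb)
  exact ⟨{ MulEquiv.ofBijective θ.toMonoidHom hb with
    continuous_toFun := θ.continuous_toFun
    continuous_invFun := e.symm.continuous }, hθ⟩

/-- Both maps are quotients of `ρ.dom` by the same subgroup. The induced bijection is continuous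
because a continuous surjection from a compact space to a Hausdorff space is a quotient map. -/
theorem IsIso.of_ker_eq {η π ρ : ProfiniteCover G} (α : ρ.dom →ₜ* η.dom) (β : ρ.dom →ₜ* π.dom)
    (hα : ∀ x, η.map (α x) = ρ.map x) (hβ : ∀ x, π.map (β x) = ρ.map x)
    (hαs : Function.Surjective α) (hβs : Function.Surjective β)
    (h : ∀ x, α x = 1 ↔ β x = 1) : η.IsIso π := by
  choose s hs using hαs
  have key : ∀ x y, α x = α y ↔ β x = β y := fun x y => by
    rw [← mul_inv_eq_one, ← map_inv, ← map_mul, h, map_mul, map_inv, mul_inv_eq_one]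
  have hsα : ∀ x, β (s (α x)) = β x := fun x => (key _ _).mp (hs _)
  have hq : Topology.IsQuotientMap α :=
    (α.continuous_toFun.isClosedMap).isQuotientMap α.continuous_toFun fun y => ⟨s y, hs y⟩
  let f : η.dom →ₜ* π.dom :=
    { toFun := fun y => β (s y)
      map_one' := by rw [← map_one α, hsα, map_one]
      map_mul' := fun y z => by
        rw [← map_mul, ← key, hs, map_mul, hs, hs]
      continuous_toFun := by
        refine hq.continuous_iff.mpr ?_
        exact β.continuous_toFun.congr fun x => (hsα x).symm }
  refine IsIso.of_bijective f (fun y => ?_) ⟨fun y z hyz => ?_, fun z => ?_⟩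
  · change π.map (β (s y)) = _
    rw [hβ, ← hα, hs]
  · have := (key (s y) (s z)).mpr hyz
    rwa [hs, hs] at this
  · obtain ⟨x, rfl⟩ := hβs z
    exact ⟨α x, hsα x⟩

theorem IsIso.symm {η π : ProfiniteCover G} (h : η.IsIso π) : π.IsIso η := by
  obtain ⟨e, he⟩ := h
  exact ⟨e.symm, fun x => by rw [← he, e.apply_symm_apply]⟩

theorem IsIso.trans {η π ρ : ProfiniteCover G} (h : η.IsIso π) (h' : π.IsIso ρ) : η.IsIso ρ := by
  obtain ⟨e, he⟩ := h
  obtain ⟨e', he'⟩ := h'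
  exact ⟨e.trans e', fun x => (he' _).trans (he x)⟩

theorem IsIso.refl (η : ProfiniteCover G) : η.IsIso η :=
  ⟨ContinuousMulEquiv.refl _, fun _ => rfl⟩

theorem IsIso.dominates {η π : ProfiniteCover G} (h : η.IsIso π) : η.Dominates π := by
  obtain ⟨e, he⟩ := h
  exact ⟨⟨e.toMulEquiv.toMonoidHom, e.continuous_toFun⟩, e.surjective, he⟩

end FiberProduct

/-! ### Homomorphisms from a kernel to a simple module -/

section Simple

variable {η : ProfiniteCover G} {A : Type u} [AddCommGroup A] [TopologicalSpace A]
  [DiscreteTopology A] [DistribMulAction G A]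

theorem kerDual_surjective (hA : IsSimpleGModule G A) {φ : kerDual η A} (hφ : φ ≠ 0) :
    Function.Surjective φ.1 := by
  let B : AddSubgroup A :=
    { carrier := Set.range φ.1
      add_mem' := by
        rintro _ _ ⟨k, rfl⟩ ⟨l, rfl⟩
        exact ⟨k * l, φ.2.2.1 k l⟩
      zero_mem' := ⟨1, kerDual_map_one φ⟩
      neg_mem' := by
        rintro _ ⟨k, rfl⟩
        exact ⟨k⁻¹, kerDual_map_inv φ k⟩ }
  have hB : B = ⊤ := (hA.2 B (by
    rintro g _ ⟨k, rfl⟩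
    obtain ⟨h, rfl⟩ := η.surj g
    exact ⟨_, φ.2.2.2 h k⟩)).resolve_left fun hb => hφ (kerDual_ext fun k =>
      AddSubgroup.mem_bot.mp (hb ▸ (⟨k, rfl⟩ : φ.1 k ∈ B)))
  exact fun a => (hB ▸ AddSubgroup.mem_top a : a ∈ B)

/-- By equivariance the kernel of `φ` is normal in `η.dom`, and the kernel of `η` is minimal normal.
-/
theorem kerDual_bijective (hη : η.IsIndecomposable) (hA : IsSimpleGModule G A) {φ : kerDual η A}
    (hφ : φ ≠ 0) : Function.Bijective φ.1 := by
  refine ⟨?_, kerDual_surjective hA hφ⟩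
  let N : Subgroup η.dom :=
    { carrier := {x | ∃ hx : x ∈ η.ker, φ.1 ⟨x, hx⟩ = 0}
      mul_mem' := by
        rintro x y ⟨hx, hx'⟩ ⟨hy, hy'⟩
        refine ⟨mul_mem hx hy, ?_⟩
        rw [← add_zero (0 : A)]
        nth_rw 1 [← hx', ← hy']
        exact φ.2.2.1 ⟨x, hx⟩ ⟨y, hy⟩
      one_mem' := ⟨one_mem _, kerDual_map_one φ⟩
      inv_mem' := by
        rintro x ⟨hx, hx'⟩
        refine ⟨inv_mem hx, ?_⟩
        rw [← neg_zero, ← hx']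
        exact kerDual_map_inv φ ⟨x, hx⟩ }
  have : N.Normal := ⟨by
    rintro x ⟨hx, hx'⟩ h
    refine ⟨η.map.toMonoidHom.normal_ker.conj_mem x hx h, ?_⟩
    have := φ.2.2.2 h ⟨x, hx⟩
    rw [hx', smul_zero] at this
    exact this⟩
  have hN : N = ⊥ := (hη.eq_bot_or_eq_ker N fun x hx => hx.1).resolve_right fun h =>
    hφ (kerDual_ext fun k => (h.ge k.2).2)
  intro k l hkl
  have hmem : (k * l⁻¹).1 ∈ N := ⟨(k * l⁻¹).2, by
    change φ.1 (k * l⁻¹) = 0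
    rw [φ.2.2.1, kerDual_map_inv, hkl, add_neg_cancel]⟩
  rw [hN, Subgroup.mem_bot] at hmem
  exact mul_inv_eq_one.mp (Subtype.ext hmem)

theorem kerIso_of_bijective {φ : kerDual η A} (hφ : Function.Bijective φ.1) : η.KerIso A :=
  ⟨{ Equiv.ofBijective φ.1 hφ with map_add' := φ.2.2.1 }, φ.2.2.2⟩

theorem KerIso.exists_kerDual (hη : η.IsIndecomposable) (h : η.KerIso A) :
    ∃ φ : kerDual η A, Function.Bijective φ.1 := by
  obtain ⟨e, he⟩ := h
  have := hη.discreteTopology_ker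
  exact ⟨⟨fun k => e (Additive.ofMul k), continuous_of_discreteTopology,
    fun k k' => e.map_add _ _, he⟩, e.bijective⟩

/-- `Hom_G(ker η, A)` is at most one-dimensional. -/
theorem exists_smul_eq {e : kerDual η A} (he : Function.Bijective e.1) (φ : kerDual η A) :
    ∃ α : gEnd G A, α • e = φ := by
  let E : η.ker ≃ A := Equiv.ofBijective e.1 he
  have hE : ∀ a, e.1 (E.symm a) = a := E.apply_symm_apply
  have hE' : ∀ k, E.symm (e.1 k) = k := E.symm_apply_apply
  let α : gEnd G A := ⟨AddMonoidHom.mk' (fun a => φ.1 (E.symm a)) fun a b => by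
    rw [← φ.2.2.1]
    refine congrArg φ.1 (he.1 ?_)
    rw [e.2.2.1, hE, hE, hE], fun g a => by
    obtain ⟨h, rfl⟩ := η.surj g
    change φ.1 _ = _ • φ.1 _
    rw [← φ.2.2.2]
    refine congrArg φ.1 (he.1 ?_)
    rw [e.2.2.2, hE, hE]⟩
  exact ⟨α, kerDual_ext fun k => congrArg φ.1 (hE' k)⟩

end Simple

section KerIso

variable {η : ProfiniteCover G} {A : Type u} [AddCommGroup A] [DistribMulAction G A]

/-- Which modules are isomorphic to the kernel depends only on its isomorphism class; this lets
chosen representatives coincide. -/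
theorem KerIso.congr {B : Type u} [AddCommGroup B] [DistribMulAction G B] {π : ProfiniteCover G}
    (h : η.KerIso A) (hπ : π.KerIso A) (h' : η.KerIso B) : π.KerIso B := by
  obtain ⟨e, he⟩ := h
  obtain ⟨e', he'⟩ := hπ
  obtain ⟨f, hf⟩ := h'
  refine ⟨(e'.trans e.symm).trans f, fun x k => ?_⟩
  obtain ⟨y, hy⟩ := η.surj (π.map x)
  obtain ⟨l, hl⟩ : ∃ l : η.ker, e (Additive.ofMul l) = e' (Additive.ofMul k) :=
    ⟨(e.symm (e' (Additive.ofMul k))).toMul, e.apply_symm_apply _⟩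
  have h1 : e.symm (e' (Additive.ofMul k)) = Additive.ofMul l := by
    rw [← hl, e.symm_apply_apply]
  have h2 : e.symm (e' (Additive.ofMul (MulAut.conjNormal x k))) =
      Additive.ofMul (MulAut.conjNormal y l) := by
    rw [AddEquiv.symm_apply_eq, he', he, hl, hy]
  simp only [AddEquiv.trans_apply]
  rw [h1, h2, hf, hy]

theorem KerIso.hasAbelianKernel (h : η.KerIso A) : η.HasAbelianKernel := by
  obtain ⟨e, -⟩ := h
  intro x hx y hy
  have : Additive.ofMul ((⟨x, hx⟩ : η.ker) * ⟨y, hy⟩) =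
      Additive.ofMul ((⟨y, hy⟩ : η.ker) * ⟨x, hx⟩) :=
    e.injective (by rw [ofMul_mul, ofMul_mul, map_add, map_add, add_comm])
  exact congrArg Subtype.val (Additive.ofMul.injective this)

end KerIso

end ProfiniteCover

/-- A finite simple discrete `G`-module. -/
structure FiniteSimpleModule (G : ProfiniteGrp.{u}) : Type (u + 1) where
  /-- the underlying type -/
  carrier : Type u
  [addCommGroup : AddCommGroup carrier]
  [finite : Finite carrier]
  [topologicalSpace : TopologicalSpace carrier]
  [discreteTopology : DiscreteTopology carrier]
  [distribMulAction : DistribMulAction G carrier]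
  [continuousSMul : ContinuousSMul G carrier]
  isSimple : IsSimpleGModule G carrier

attribute [instance] FiniteSimpleModule.addCommGroup FiniteSimpleModule.finite
  FiniteSimpleModule.topologicalSpace FiniteSimpleModule.discreteTopology
  FiniteSimpleModule.distribMulAction FiniteSimpleModule.continuousSMul

namespace ProfiniteCover

variable {G : ProfiniteGrp.{u}}

/-- An abelian kernel of an indecomposable cover is a finite simple module. -/
theorem IsIndecomposable.exists_kerIso {η : ProfiniteCover G} (h : η.IsIndecomposable)
    (hab : η.HasAbelianKernel) : ∃ A : FiniteSimpleModule G, η.KerIso A.carrier := by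
  obtain ⟨s, hsc, hs⟩ := h.hasContinuousSection
  have hd := h.discreteTopology_ker
  have hf := h.finite_ker
  let gr : AddCommGroup (Additive η.ker) :=
    { (inferInstance : AddGroup (Additive η.ker)) with
      add_comm := fun a b => Subtype.ext (hab _ a.toMul.2 _ b.toMul.2) }
  -- A commutative kernel acts trivially on itself by conjugation, so conjugation depends only on
  -- the image in `G`.
  have hconj : ∀ (x y : η.dom) (k : η.ker), η.map x = η.map y →
      MulAut.conjNormal x k = MulAut.conjNormal y k := fun x y k hxy => by
    have hmem : y⁻¹ * x ∈ η.ker := by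
      rw [mem_ker, map_mul, map_inv, hxy, inv_mul_cancel]
    have := hab _ hmem _ k.2
    refine Subtype.ext ?_
    rw [MulAut.conjNormal_apply, MulAut.conjNormal_apply, mul_inv_eq_iff_eq_mul]
    have h2 : x = y * (y⁻¹ * x) := (mul_inv_cancel_left y x).symm
    rw [h2, mul_assoc, this]
    group
  let act : DistribMulAction G (Additive η.ker) :=
    { smul := fun g a => Additive.ofMul (MulAut.conjNormal (s g) a.toMul)
      one_smul := fun a => congrArg Additive.ofMul (by
        rw [hconj (s 1) 1 _ (by rw [hs, map_one]), map_one]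
        rfl)
      mul_smul := fun g g' a => congrArg Additive.ofMul (by
        rw [hconj (s (g * g')) (s g * s g') _ (by rw [map_mul, hs, hs, hs]), map_mul]
        rfl)
      smul_zero := fun g => congrArg Additive.ofMul (map_one _)
      smul_add := fun g a b => congrArg Additive.ofMul (map_mul _ _ _) }
  have hsmul : ∀ (x : η.dom) (a : Additive η.ker),
      η.map x • a = Additive.ofMul (MulAut.conjNormal x a.toMul) := fun x a =>
    congrArg Additive.ofMul (hconj _ _ _ (hs _))
  let top : TopologicalSpace (Additive η.ker) := ⊥
  have hdt : DiscreteTopology (Additive η.ker) := ⟨rfl⟩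
  have hcs : ContinuousSMul G (Additive η.ker) := by
    refine ⟨continuous_prod_of_discrete_right.mpr fun a => ?_⟩
    have h1 : Continuous fun g => MulAut.conjNormal (s g) a.toMul := by
      refine Continuous.subtype_mk (p := fun x => x ∈ η.ker) ?_
        fun g => (MulAut.conjNormal (s g) a.toMul).2
      simp only [MulAut.conjNormal_apply]
      exact (hsc.mul continuous_const).mul hsc.inv
    exact (continuous_of_discreteTopology (f := Additive.ofMul (α := η.ker))).comp h1
  have hsimple : IsSimpleGModule G (Additive η.ker) := by
    refine ⟨?_, fun B hB => ?_⟩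
    · obtain ⟨k, hk, hk1⟩ := h.exists_ker_ne_one
      exact ⟨Additive.ofMul ⟨k, hk⟩, 0, fun h0 => hk1 (congrArg Subtype.val h0)⟩
    -- A submodule of the kernel is a normal subgroup of `η.dom`, so simplicity is minimality of the
    -- kernel.
    · let N : Subgroup η.dom := (AddSubgroup.toSubgroup' B).map η.ker.subtype
      have hmemN : ∀ k : η.ker, k.1 ∈ N ↔ Additive.ofMul k ∈ B := fun k =>
        ⟨fun ⟨l, hl, hlk⟩ => Subtype.ext hlk ▸ hl, fun hk => ⟨k, hk, rfl⟩⟩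
      have hNk : N ≤ η.ker := by
        rintro _ ⟨k, -, rfl⟩
        exact k.2
      have : N.Normal := ⟨by
        rintro _ ⟨k, hk, rfl⟩ x
        have : Additive.ofMul (MulAut.conjNormal x k) ∈ B :=
          hsmul x (Additive.ofMul k) ▸ hB (η.map x) (Additive.ofMul k) hk
        exact ⟨_, this, rfl⟩⟩
      rcases h.eq_bot_or_eq_ker N hNk with hN | hN
      · refine Or.inl ((AddSubgroup.eq_bot_iff_forall B).mpr fun b hb => ?_)
        have : b.toMul.1 ∈ N := (hmemN _).mpr hb
        rw [hN, Subgroup.mem_bot] at this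
        exact congrArg Additive.ofMul (Subtype.ext this : b.toMul = 1)
      · exact Or.inr ((AddSubgroup.eq_top_iff' B).mpr fun b =>
          (hmemN b.toMul).mp (hN.ge b.toMul.2))
  refine ⟨{ carrier := Additive η.ker, isSimple := hsimple }, ⟨AddEquiv.refl _, fun x k => ?_⟩⟩
  exact (hsmul x _).symm

/-! ### Duals and non-abelian quotients of a fiber product -/

section FiberProduct

variable {I : Type u} {η : I → ProfiniteCover G}

/-- `φ` vanishes near `1`, hence on all elements of the kernel that are trivial at some finite set
of coordinates; so it is a sum of homomorphisms through these coordinates. -/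
theorem mem_iSup_range_proj (hη : ∀ i, (η i).IsIndecomposable) {A : Type u} [AddCommGroup A]
    [TopologicalSpace A] [DiscreteTopology A] [DistribMulAction G A]
    (φ : kerDual (fiberProduct η) A) :
    φ ∈ ⨆ i, LinearMap.range (dualMap A (proj η i) (map_proj η i)) := by
  have hopen : IsOpen {k : (fiberProduct η).ker | φ.1 k = 0} :=
    (isOpen_discrete {(0 : A)}).preimage φ.2.1
  obtain ⟨W, hW, hW'⟩ := isOpen_induced_iff.mp hopen
  obtain ⟨F, hF⟩ := exists_finset_commonKer_subset hW (by
    have : (1 : (fiberProduct η).ker) ∈ Subtype.val ⁻¹' W := hW' ▸ kerDual_map_one φ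
    exact this)
  have := mem_iSup_range_dualMap (proj η) hη proj_surjective (map_proj η) F φ fun k hk => by
    have : k ∈ Subtype.val ⁻¹' W := hF _ hk
    rw [hW'] at this
    exact this
  exact (iSup₂_le fun i _ => le_iSup
    (fun i => LinearMap.range (dualMap A (proj η i) (map_proj η i))) i) this

/-- An indecomposable quotient with non-abelian kernel of the fiber product is one of the
projections. -/
theorem exists_proj_eq_one_iff (hη : ∀ i, (η i).IsIndecomposable) {ζ : ProfiniteCover G}
    (hζ : ζ.IsIndecomposable) (hna : ¬ ζ.HasAbelianKernel) (ψ : (fiberProduct η).dom →ₜ* ζ.dom)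
    (hψs : Function.Surjective ψ) (hψ : ∀ x, ζ.map (ψ x) = (fiberProduct η).map x) :
    ∃ i, ∀ x, proj η i x = 1 ↔ ψ x = 1 := by
  obtain ⟨U, hU⟩ := hζ.exists_openNormalSubgroup
  obtain ⟨F, hF⟩ := exists_finset_commonKer_subset
    ((show IsOpen (U.toSubgroup : Set ζ.dom) from U.isOpen').preimage ψ.continuous_toFun)
    (by
      change ψ 1 ∈ U.toSubgroup
      rw [map_one]
      exact one_mem _)
  obtain ⟨i, -, hi⟩ := exists_mem_forall_map_eq_one (proj η) hζ hna ψ hψs hψ F fun x hx => by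
    have : ψ x ∈ ζ.ker ⊓ U.toSubgroup := ⟨(hψ x).trans hx.1, hF x hx⟩
    rwa [hU, Subgroup.mem_bot] at this
  have hk : ∀ x, proj η i x = 1 → x ∈ (fiberProduct η).ker := fun x hx => by
    rw [mem_ker, ← map_proj η i, hx, map_one]
  have hk' : ∀ x, ψ x = 1 → x ∈ (fiberProduct η).ker := fun x hx => by
    rw [mem_ker, ← hψ, hx, map_one]
  refine ⟨i, fun x => ⟨fun hx => hi x (hk x hx) hx, fun hx => ?_⟩⟩
  -- Otherwise the kernel of `ψ` maps onto the kernel of `η i`. Every element of the kernel of the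
  -- fiber product is then a product of one killed by `ψ` and one killed by `proj η i`, so `ψ` kills
  -- it, although the kernel of `ζ` is nontrivial.
  by_contra hne
  obtain ⟨k, hkk, hk1⟩ := hζ.exists_ker_ne_one
  obtain ⟨y, rfl⟩ := hψs k
  have hy : y ∈ (fiberProduct η).ker := by rwa [mem_ker, ← hψ]
  obtain ⟨m, hm, hmy⟩ := (hη i).exists_mem_map_eq (proj η i) (proj_surjective i) (map_proj η i)
    ψ.toMonoidHom.ker (fun z hz => hk' z hz) ⟨x, hx, hne⟩
    (k := proj η i y) (by rw [mem_ker, map_proj]; exact hy)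
  have hm' : ψ m = 1 := hm
  apply hk1
  have h1 : proj η i (m⁻¹ * y) = 1 := by rw [map_mul, map_inv, hmy, inv_mul_cancel]
  have h2 := hi _ (hk _ h1) h1
  rwa [map_mul, map_inv, hm', inv_one, one_mul] at h2

theorem proj_injective_index (hη : ∀ i, (η i).IsIndecomposable) {i j : I}
    (h : ∀ x, proj η i x = 1 → proj η j x = 1) : i = j := by
  by_contra hne
  obtain ⟨k, hk, hk1⟩ := (hη j).exists_ker_ne_one
  obtain ⟨x, -, hx, hx'⟩ := exists_proj_eq_of_mem_ker j hk
  exact hk1 (hx ▸ h x (hx' i hne))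

section

variable (A : Type u) [AddCommGroup A] [DistribMulAction G A]

/-- The projection of the fiber product to its `A`-isotypic part. -/
def projIsotypic (η : I → ProfiniteCover G) :
    (fiberProduct η).dom →ₜ* (isotypicPart η A).dom :=
  lift (fun i => proj η i) fun i => map_proj η i

theorem projIsotypic_surjective : Function.Surjective (projIsotypic A η) := by
  classical
  intro y
  obtain ⟨x, hx, hx'⟩ := exists_fiberProduct (η := η) ((isotypicPart η A).map y)
    (fun i => if h : (η i).KerIso A then proj (fun i : ModuleIndex η A => η i) ⟨i, h⟩ y
      else ((η i).surj ((isotypicPart η A).map y)).choose) fun i => by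
    by_cases h : (η i).KerIso A
    · simp only [h, dite_true]
      exact map_proj (fun i : ModuleIndex η A => η i) ⟨i, h⟩ y
    · simp only [h, dite_false]
      exact ((η i).surj ((isotypicPart η A).map y)).choose_spec
  refine ⟨x, fiberProduct_ext hx fun i => ?_⟩
  refine (hx' i).trans ?_
  simp [i.2]

end

variable {A : Type u} [AddCommGroup A] [TopologicalSpace A] [DiscreteTopology A]
  [DistribMulAction G A]

/-- A nonzero homomorphism from the kernel of `η i` to `A` is bijective, so only factors already
present in the isotypic part contribute. -/
theorem dualMap_projIsotypic_surjective (hη : ∀ i, (η i).IsIndecomposable)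
    (hA : IsSimpleGModule G A) :
    Function.Surjective (dualMap A (projIsotypic A η) (map_lift _ _)) := by
  rw [← LinearMap.range_eq_top, eq_top_iff]
  refine fun φ _ => iSup_le (a := LinearMap.range _) (fun i => ?_) (mem_iSup_range_proj hη φ)
  rintro _ ⟨e, rfl⟩
  by_cases he : e = 0
  · rw [he, map_zero]
    exact zero_mem _
  · let i' : ModuleIndex η A := ⟨i, kerIso_of_bijective (kerDual_bijective (hη i) hA he)⟩
    exact ⟨dualMap A (proj (fun i : ModuleIndex η A => η i) i') (map_proj _ i') e, rfl⟩

variable (hη : ∀ i, (η i).IsIndecomposable)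

include hη in
theorem hasContinuousSection_fiberProduct_of_isIndecomposable :
    (fiberProduct η).HasContinuousSection :=
  hasContinuousSection_fiberProduct _ fun i => (hη i).hasContinuousSection

/-- Replaces `S_A` by the map of the whole fiber product, which is functorial for homomorphisms over
`G`. -/
theorem range_isotypicMap (hA : IsSimpleGModule G A) :
    LinearMap.range (isotypicMap A hη) =
      LinearMap.range (dualToH2 (A := A)
        (hasContinuousSection_fiberProduct_of_isIndecomposable hη)) := by
  refine le_antisymm (range_dualToH2_le (projIsotypic A η) (map_lift _ _) _ _) ?_
  rintro _ ⟨φ, rfl⟩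
  obtain ⟨ψ, rfl⟩ := dualMap_projIsotypic_surjective hη hA φ
  exact ⟨ψ, (dualToH2_dualMap _ _ _ _ ψ).symm⟩

theorem rank_ker_isotypicMap (hA : IsSimpleGModule G A) :
    Module.rank (gEnd G A) (LinearMap.ker (isotypicMap A hη)) =
      Module.rank (gEnd G A) (LinearMap.ker (dualToH2 (A := A)
        (hasContinuousSection_fiberProduct_of_isIndecomposable hη))) := by
  let E := LinearEquiv.ofBijective (dualMap A (projIsotypic A η) (map_lift _ _))
    ⟨dualMap_injective _ _ (projIsotypic_surjective A), dualMap_projIsotypic_surjective hη hA⟩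
  refine LinearEquiv.rank_eq (E.ofSubmodules _ _ ?_)
  ext φ
  obtain ⟨ψ, rfl⟩ := E.surjective φ
  rw [Submodule.mem_map_equiv, E.symm_apply_apply, LinearMap.mem_ker, LinearMap.mem_ker]
  exact Eq.congr_left (dualToH2_dualMap _ _ _ _ ψ).symm

end FiberProduct

section Dominates

variable {I I' : Type u} {η : I → ProfiniteCover G} {η' : I' → ProfiniteCover G}

/-- A projection of type `ζ`, composed with `θ`, has the same kernel as a projection of the first
fiber product. Since `θ` is onto, that kernel determines the kernel of the original projection,
hence its index. -/
theorem Dominates.mk_isoIndex_le (h : (fiberProduct η).Dominates (fiberProduct η'))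
    (hη : ∀ i, (η i).IsIndecomposable) (hη' : ∀ i, (η' i).IsIndecomposable)
    {ζ : ProfiniteCover G} (hζ : ζ.IsIndecomposable) (hna : ¬ ζ.HasAbelianKernel) :
    Cardinal.mk (IsoIndex η' ζ) ≤ Cardinal.mk (IsoIndex η ζ) := by
  obtain ⟨θ, hs, hθ⟩ := h
  have key : ∀ i' : IsoIndex η' ζ, ∃ i : IsoIndex η ζ,
      ∀ x, proj η i x = 1 ↔ proj η' i' (θ x) = 1 := by
    rintro ⟨i', hi'⟩
    obtain ⟨e₀, he⟩ := hi'
    let e : (η' i').dom →ₜ* ζ.dom := ⟨e₀.toMulEquiv.toMonoidHom, e₀.continuous_toFun⟩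
    have hei : ∀ x, e x = 1 → x = 1 := fun x hx => e₀.injective (hx.trans (map_one e₀).symm)
    let ψ : (fiberProduct η).dom →ₜ* ζ.dom := (e.comp (proj η' i')).comp θ
    have hψ : ∀ x, ζ.map (ψ x) = (fiberProduct η).map x := fun x => by
      rw [← hθ, ← map_proj η' i', ← he]
      rfl
    have hψs : Function.Surjective ψ := e₀.surjective.comp ((proj_surjective i').comp hs)
    obtain ⟨i, hi⟩ := exists_proj_eq_one_iff hη hζ hna ψ hψs hψ
    refine ⟨⟨i, IsIso.of_ker_eq _ _ (map_proj η i) hψ (proj_surjective i) hψs hi⟩, fun x => ?_⟩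
    rw [hi]
    exact ⟨hei _, fun hx => (congrArg e hx).trans (map_one e)⟩
  choose f hf using key
  refine Cardinal.mk_le_of_injective (f := f) fun i' j' hij => Subtype.ext ?_
  refine proj_injective_index hη' fun y hy => ?_
  obtain ⟨x, rfl⟩ := hs y
  rw [← hf, ← hij, hf]
  exact hy

end Dominates

end ProfiniteCover

namespace ProfiniteCover

variable {G : ProfiniteGrp.{u}}

theorem IsIso.hasAbelianKernel {η π : ProfiniteCover G} (h : η.IsIso π)
    (hπ : π.HasAbelianKernel) : η.HasAbelianKernel := by
  obtain ⟨e, he⟩ := h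
  intro x hx y hy
  refine e.injective ?_
  rw [map_mul, map_mul]
  exact hπ _ (by rwa [mem_ker, he]) _ (by rwa [mem_ker, he])

/-- The homomorphisms `ker η → A` that vanish at `k`. -/
def kerDualVanishing (η : ProfiniteCover G) (A : Type u) [AddCommGroup A] [TopologicalSpace A]
    [DiscreteTopology A] [DistribMulAction G A] (k : η.ker) :
    Submodule (gEnd G A) (kerDual η A) where
  carrier := {φ | φ.1 k = 0}
  add_mem' {φ φ'} hφ hφ' := by
    change φ.1 k + φ'.1 k = 0
    rw [hφ, hφ', add_zero]
  zero_mem' := rfl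
  smul_mem' α φ hφ := (congrArg α.1 hφ).trans (map_zero α.1)

theorem dualMap_mem_kerDualVanishing {η π : ProfiniteCover G} {A : Type u} [AddCommGroup A]
    [TopologicalSpace A] [DiscreteTopology A] [DistribMulAction G A] (θ : η.dom →ₜ* π.dom)
    (hθ : ∀ x, π.map (θ x) = η.map x) {k : η.ker} (hk : θ k = 1) :
    LinearMap.range (dualMap A θ hθ) ≤ kerDualVanishing η A k := by
  rintro _ ⟨e, rfl⟩
  have : kerMap θ hθ k = 1 := Subtype.ext hk
  change e.1 (kerMap θ hθ k) = 0
  rw [this, kerDual_map_one]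

/-- A homomorphism over `G` that extends a nonzero homomorphism to a simple kernel is
surjective. -/
theorem surjective_of_dualMap_ne_zero {η π : ProfiniteCover G} {A : Type u} [AddCommGroup A]
    [TopologicalSpace A] [DiscreteTopology A] [DistribMulAction G A] (hA : IsSimpleGModule G A)
    (θ : η.dom →ₜ* π.dom) (hθ : ∀ x, π.map (θ x) = η.map x) {e : kerDual π A}
    (he : Function.Injective e.1) (h0 : dualMap A θ hθ e ≠ 0) : Function.Surjective θ := by
  intro y
  obtain ⟨x, hx⟩ := η.surj (π.map y)
  have hk : y * (θ x)⁻¹ ∈ π.ker := by rw [mem_ker, map_mul, map_inv, hθ, hx, mul_inv_cancel]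
  obtain ⟨k, hk'⟩ := kerDual_surjective hA h0 (e.1 ⟨_, hk⟩)
  have : θ k = y * (θ x)⁻¹ := congrArg Subtype.val (he hk')
  exact ⟨k * x, by rw [map_mul, this, inv_mul_cancel_right]⟩

/-! ### Construction of the epimorphism and of the isomorphism -/

section Families

variable {I I' : Type u} {η : I → ProfiniteCover G} {η' : I' → ProfiniteCover G}

/-- Injections `I'_ζ → I_ζ` for all `ζ` give an injection of the indices with non-abelian
kernel. -/
theorem exists_injective_index (hη' : ∀ i, (η' i).IsIndecomposable)
    (f : ∀ ζ : ProfiniteCover G, ζ.IsIndecomposable → ¬ ζ.HasAbelianKernel →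
      IsoIndex η' ζ → IsoIndex η ζ)
    (hf : ∀ ζ hζ hna, Function.Injective (f ζ hζ hna)) :
    ∃ m : {i : I' // ¬ (η' i).HasAbelianKernel} → I, Function.Injective m ∧
      (∀ i, (η (m i)).IsIso (η' i)) ∧
      ((∀ ζ hζ hna, Function.Surjective (f ζ hζ hna)) → (∀ i, (η i).IsIndecomposable) →
        ∀ i, ¬ (η i).HasAbelianKernel → ∃ i', m i' = i) := by
  -- The representative is chosen from a predicate that depends only on the isomorphism class, so
  -- isomorphic members get equal representatives and hence the same injection `f ζ`.
  have hex : ∀ i : I', ∃ ζ : ProfiniteCover G, (η' i).IsIso ζ ∧ ζ.IsIndecomposable := fun i =>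
    ⟨η' i, IsIso.refl _, hη' i⟩
  let r : I' → ProfiniteCover G := fun i => (hex i).choose
  have hr : ∀ i, (η' i).IsIso (r i) := fun i => (hex i).choose_spec.1
  have hri : ∀ i, (r i).IsIndecomposable := fun i => (hex i).choose_spec.2
  have hreq : ∀ i j, (η' i).IsIso (η' j) → r i = r j := fun i j hij => by
    have : (fun ζ : ProfiniteCover G => (η' i).IsIso ζ ∧ ζ.IsIndecomposable) =
        fun ζ => (η' j).IsIso ζ ∧ ζ.IsIndecomposable := by
      funext ζ
      exact propext ⟨fun h => ⟨hij.symm.trans h.1, h.2⟩, fun h => ⟨hij.trans h.1, h.2⟩⟩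
    simp only [r, this]
  have hrna : ∀ i : {i : I' // ¬ (η' i).HasAbelianKernel}, ¬ (r i).HasAbelianKernel :=
    fun i h => i.2 ((hr i).hasAbelianKernel h)
  let m : {i : I' // ¬ (η' i).HasAbelianKernel} → I := fun i =>
    f (r i) (hri i) (hrna i) ⟨i, hr i⟩
  have hm : ∀ (i : {i : I' // ¬ (η' i).HasAbelianKernel}) (ζ : ProfiniteCover G) (hζ)
      (hna) (hi : (η' i.1).IsIso ζ), r i = ζ → m i = f ζ hζ hna ⟨i, hi⟩ := by
    rintro i _ hζ hna hi rfl
    rfl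
  have hmr : ∀ i, (η (m i)).IsIso (r i) := fun i => (f (r i) (hri i) (hrna i) ⟨i, hr i⟩).2
  refine ⟨m, fun i j hij => ?_, fun i => (hmr i).trans (hr i).symm, fun hsur hη i hi => ?_⟩
  · have h1 : (r i).IsIso (r j) := (hmr i).symm.trans (hij ▸ hmr j)
    have h2 : (η' i).IsIso (r j) := (hr i).trans h1
    have h3 : r i = r j := hreq i j (h2.trans (hr j).symm)
    rw [hm i (r j) (hri j) (hrna j) h2 h3] at hij
    exact Subtype.ext (congrArg Subtype.val (hf _ _ _ (Subtype.ext hij)) :)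
  -- Surjectivity is used twice: at `η i`, to find some isomorphic member `i'`, and then at the
  -- representative of `i'`, where `m` takes its values.
  · obtain ⟨⟨i', hi'⟩, -⟩ := hsur (η i) (hη i) hi ⟨i, IsIso.refl _⟩
    have hna : ¬ (η' i').HasAbelianKernel := fun h => hi (hi'.symm.hasAbelianKernel h)
    obtain ⟨⟨l, hl⟩, hli⟩ := hsur (r i') (hri i') (hrna ⟨i', hna⟩) ⟨i, hi'.symm.trans (hr i')⟩
    have hl' : (η' l).IsIso (η' i') := hl.trans (hr i').symm
    refine ⟨⟨l, fun h => hna (hl'.symm.hasAbelianKernel h)⟩, ?_⟩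
    rw [hm _ (r i') (hri i') (hrna ⟨i', hna⟩) hl (hreq _ _ hl'), hli]

/-- Components of a homomorphism of fiber products adapted to a map `m` of the indices with
non-abelian kernel and to linear maps `j A` of the dual kernels. -/
structure AdaptedComponents (m : {i : I' // ¬ (η' i).HasAbelianKernel} → I)
    (j : ∀ A : FiniteSimpleModule G, kerDual (fiberProduct η') A.carrier →ₗ[gEnd G A.carrier]
      kerDual (fiberProduct η) A.carrier) where
  /-- the components -/
  hom : ∀ i, (fiberProduct η).dom →ₜ* (η' i).dom
  map_hom : ∀ i x, (η' i).map (hom i x) = (fiberProduct η).map x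
  surjective : ∀ i, Function.Surjective (hom i)
  hom_eq_one_iff : ∀ (i : {i : I' // ¬ (η' i).HasAbelianKernel}) x,
    hom i x = 1 ↔ proj η (m i) x = 1
  /-- the chosen representatives of the isomorphism classes of abelian kernels -/
  rep : ∀ i, (η' i).HasAbelianKernel → FiniteSimpleModule G
  kerIso_rep : ∀ i hi, (η' i).KerIso (rep i hi).carrier
  dualMap_hom : ∀ (i l : I') (hl : (η' l).HasAbelianKernel)
    (e : kerDual (η' i) (rep l hl).carrier),
    dualMap _ (hom i) (map_hom i) e = j _ (dualMap _ (proj η' i) (map_proj η' i) e)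

/-- In the abelian case `j` preserves classes, so the image of a coordinate homomorphism extends to
a component; it is onto because `j` is injective. In the non-abelian case the component is a
projection followed by an isomorphism. -/
theorem exists_adaptedComponents (hη : ∀ i, (η i).IsIndecomposable)
    (hη' : ∀ i, (η' i).IsIndecomposable) (m : {i : I' // ¬ (η' i).HasAbelianKernel} → I)
    (hm : ∀ i, (η (m i)).IsIso (η' i))
    (j : ∀ A : FiniteSimpleModule G, kerDual (fiberProduct η') A.carrier →ₗ[gEnd G A.carrier]
      kerDual (fiberProduct η) A.carrier)
    (hj : ∀ A, Function.Injective (j A))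
    (hjS : ∀ (A : FiniteSimpleModule G) (x),
      dualToH2 (A := A.carrier) (hasContinuousSection_fiberProduct_of_isIndecomposable hη) (j A x) =
        dualToH2 (A := A.carrier) (hasContinuousSection_fiberProduct_of_isIndecomposable hη') x) :
    Nonempty (AdaptedComponents m j) := by
  classical
  have hex : ∀ i, (η' i).HasAbelianKernel → ∃ A : FiniteSimpleModule G, (η' i).KerIso A.carrier :=
    fun i hi => (hη' i).exists_kerIso hi
  let r : ∀ i, (η' i).HasAbelianKernel → FiniteSimpleModule G := fun i hi => (hex i hi).choose
  have hr : ∀ i hi, (η' i).KerIso (r i hi).carrier := fun i hi => (hex i hi).choose_spec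
  have hreq : ∀ i l hi hl, (η' i).KerIso (r l hl).carrier → r i hi = r l hl := by
    intro i l hi hl h
    have : (fun A : FiniteSimpleModule G => (η' i).KerIso A.carrier) =
        fun A => (η' l).KerIso A.carrier := by
      funext A
      exact propext ⟨fun h' => h.congr (hr l hl) h', fun h' => (hr l hl).congr h h'⟩
    simp only [r, this]
  have hcomp : ∀ i, ∃ (θ : (fiberProduct η).dom →ₜ* (η' i).dom)
      (hθ : ∀ x, (η' i).map (θ x) = (fiberProduct η).map x), Function.Surjective θ ∧
      (∀ hi : ¬ (η' i).HasAbelianKernel, ∀ x, θ x = 1 ↔ proj η (m ⟨i, hi⟩) x = 1) ∧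
      (∀ (hi : (η' i).HasAbelianKernel) (e : kerDual (η' i) (r i hi).carrier),
        dualMap _ θ hθ e = j _ (dualMap _ (proj η' i) (map_proj η' i) e)) := by
    intro i
    by_cases hi : (η' i).HasAbelianKernel
    · obtain ⟨e, he⟩ := (hr i hi).exists_kerDual (hη' i)
      have := (hη' i).discreteTopology_ker
      have hsec := hasContinuousSection_fiberProduct_of_isIndecomposable hη
      have hsec' := hasContinuousSection_fiberProduct_of_isIndecomposable hη'
      obtain ⟨θ, hθ, hθe⟩ := exists_dualMap_eq hsec (hη' i).hasContinuousSection
        (j _ (dualMap _ (proj η' i) (map_proj η' i) e)) e he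
        ((hjS _ _).trans (dualToH2_dualMap _ _ hsec' _ e))
      refine ⟨θ, hθ, ?_, fun h => absurd hi h, fun _ e' => ?_⟩
      · refine surjective_of_dualMap_ne_zero (r i hi).isSimple θ hθ he.1 ?_
        rw [hθe]
        intro h0
        have h1 := dualMap_injective _ _ (proj_surjective i)
          ((hj _ (h0.trans (map_zero _).symm)).trans (map_zero _).symm)
        obtain ⟨k, hk, hk1⟩ := (hη' i).exists_ker_ne_one
        refine hk1 (congrArg Subtype.val (he.1 (?_ : e.1 ⟨k, hk⟩ = e.1 1)))
        rw [h1]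
        rfl
      -- `e` spans the dual of the kernel over `gEnd`, so agreement at `e` suffices by linearity.
      · obtain ⟨α, rfl⟩ := exists_smul_eq he e'
        rw [map_smul, map_smul, map_smul, hθe]
    · obtain ⟨e, he⟩ := hm ⟨i, hi⟩
      let e' : (η (m ⟨i, hi⟩)).dom →ₜ* (η' i).dom :=
        ⟨e.toMulEquiv.toMonoidHom, e.continuous_toFun⟩
      refine ⟨e'.comp (proj η (m ⟨i, hi⟩)), fun x => ?_, e.surjective.comp (proj_surjective _),
        fun _ x => ⟨fun hx => e.injective (hx.trans (map_one e).symm),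
          fun hx => (congrArg e hx).trans (map_one e)⟩, fun h => absurd h hi⟩
      exact (he _).trans (map_proj η _ x)
  choose θ hθ hs hna hab using hcomp
  refine ⟨⟨θ, hθ, hs, fun i => hna i.1 i.2, r, hr, fun i l hl e => ?_⟩⟩
  by_cases he : e = 0
  · rw [he, map_zero, map_zero, map_zero]
  · have hk := kerIso_of_bijective (kerDual_bijective (hη' i) (r l hl).isSimple he)
    have hi := hk.hasAbelianKernel
    have heq := hreq i l hi hl hk
    have := hab i hi
    rw [heq] at this
    exact this e

namespace AdaptedComponents

variable {m : {i : I' // ¬ (η' i).HasAbelianKernel} → I}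
  {j : ∀ A : FiniteSimpleModule G, kerDual (fiberProduct η') A.carrier →ₗ[gEnd G A.carrier]
    kerDual (fiberProduct η) A.carrier}
  (C : AdaptedComponents m j)

/-- Suppose component `l` vanishes on the common kernel for `F`. If its kernel is abelian,
injectivity of `j` puts the coordinate homomorphism at `l` in the span of those at `F`, which an
element supported at `l` refutes. Otherwise primeness yields `i` in `F` whose component kills no
more than that of `l` does on the kernel; then the kernel of `η' i` is non-abelian too, and
injectivity of `m` gives `i = l`. -/
theorem lift_surjective (hη : ∀ i, (η i).IsIndecomposable) (hη' : ∀ i, (η' i).IsIndecomposable)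
    (hm : Function.Injective m) (hj : ∀ A, Function.Injective (j A)) :
    Function.Surjective (lift C.hom C.map_hom) := by
  refine ProfiniteCover.lift_surjective hη' C.hom C.map_hom C.surjective fun F l hlF => ?_
  by_contra! hc
  by_cases hl : (η' l).HasAbelianKernel
  · obtain ⟨e, he⟩ := (C.kerIso_rep l hl).exists_kerDual (hη' l)
    have h1 := mem_iSup_range_dualMap C.hom hη' C.surjective C.map_hom F
      (dualMap _ (C.hom l) (C.map_hom l) e) fun k hk => by
        rw [dualMap_apply, show kerMap (C.hom l) (C.map_hom l) k = 1 from Subtype.ext (hc _ hk),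
          kerDual_map_one]
    have h2 : ⨆ i ∈ F, LinearMap.range
        (dualMap (C.rep l hl).carrier (C.hom i) (C.map_hom i)) ≤
        (⨆ i ∈ F, LinearMap.range
          (dualMap (C.rep l hl).carrier (proj η' i) (map_proj η' i))).map (j _) := by
      refine iSup₂_le fun i hi => ?_
      rintro _ ⟨e', rfl⟩
      rw [C.dualMap_hom]
      exact Submodule.mem_map_of_mem (Submodule.mem_iSup_of_mem i
        (Submodule.mem_iSup_of_mem hi ⟨e', rfl⟩))
    obtain ⟨w, hw, hwe⟩ := h2 h1
    rw [C.dualMap_hom] at hwe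
    rw [hj _ hwe] at hw
    obtain ⟨k, hk, hk1⟩ := (hη' l).exists_ker_ne_one
    obtain ⟨x, hx, hxk, hx'⟩ := exists_proj_eq_of_mem_ker l hk
    have h3 : ⨆ i ∈ F, LinearMap.range
        (dualMap (C.rep l hl).carrier (proj η' i) (map_proj η' i)) ≤
        kerDualVanishing _ _ ⟨x, hx⟩ := iSup₂_le fun i hi =>
      dualMap_mem_kerDualVanishing _ _ (hx' i fun hil => hlF (hil ▸ hi))
    have h4 : e.1 (kerMap (proj η' l) (map_proj η' l) ⟨x, hx⟩) = e.1 1 :=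
      (h3 hw : _ = (0 : (C.rep l hl).carrier)).trans (kerDual_map_one e).symm
    exact hk1 (hxk ▸ congrArg Subtype.val (he.1 h4))
  · obtain ⟨i, hi, h⟩ := exists_mem_forall_map_eq_one C.hom (hη' l) hl (C.hom l)
      (C.surjective l) (C.map_hom l) F hc
    by_cases hia : (η' i).HasAbelianKernel
    · refine hl fun a ha b hb => ?_
      obtain ⟨x, rfl⟩ := C.surjective l a
      obtain ⟨y, rfl⟩ := C.surjective l b
      rw [mem_ker, C.map_hom] at ha hb
      have hcomm := hia (C.hom i x) (by rwa [mem_ker, C.map_hom]) (C.hom i y)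
        (by rwa [mem_ker, C.map_hom])
      have := h (x * y * (y * x)⁻¹) (by
        rw [mem_ker, map_mul, map_mul, map_inv, map_mul, ha, hb]
        simp) (by
        rw [map_mul, map_mul, map_inv, map_mul, hcomm, mul_inv_cancel])
      rwa [map_mul, map_mul, map_inv, map_mul, mul_inv_eq_one] at this
    · have h1 : m ⟨i, hia⟩ = m ⟨l, hl⟩ := proj_injective_index hη fun x hx => by
        rw [← C.hom_eq_one_iff] at hx ⊢
        refine h x ?_ hx
        rw [mem_ker, ← C.map_hom i, hx, map_one]
      have h2 : i = l := congrArg Subtype.val (hm h1)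
      exact hlF (h2 ▸ hi)

/-- For `x` killed by all components, non-abelian coordinates vanish since `m` reaches them. At an
abelian coordinate, surjectivity of `j` expresses its homomorphism as `j w`; as `w` is a sum through
projections, `j w` is a sum through components and vanishes at `x`. -/
theorem lift_injective (hη : ∀ i, (η i).IsIndecomposable) (hη' : ∀ i, (η' i).IsIndecomposable)
    (hm : ∀ i, ¬ (η i).HasAbelianKernel → ∃ i', m i' = i)
    (hj : ∀ A, Function.Surjective (j A)) :
    Function.Injective (lift C.hom C.map_hom) := by
  refine (injective_iff_map_eq_one _).mpr fun x hx => ?_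
  have hxk : x ∈ (fiberProduct η).ker := by
    rw [mem_ker, ← map_lift C.hom C.map_hom, hx, map_one]
  have hx1 : ∀ i, C.hom i x = 1 := fun i => by
    rw [← proj_lift C.hom C.map_hom, hx, map_one]
  refine fiberProduct_ext (hxk.trans (map_one _).symm) fun i => ?_
  rw [map_one]
  by_cases hi : (η i).HasAbelianKernel
  · obtain ⟨B, hB⟩ := (hη i).exists_kerIso hi
    obtain ⟨e, he⟩ := hB.exists_kerDual (hη i)
    obtain ⟨w, hw⟩ := hj B (dualMap _ (proj η i) (map_proj η i) e)
    -- `dualMap_hom` concerns only the chosen representatives, so `B` must be replaced by one. If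
    -- `B` did not occur in the second family, `w` and hence `e` would be zero.
    obtain ⟨l, hl⟩ : ∃ l, (η' l).KerIso B.carrier := by
      by_contra! hc
      have h0 : ⨆ l, LinearMap.range (dualMap B.carrier (proj η' l) (map_proj η' l)) ≤ ⊥ := by
        refine iSup_le fun l => ?_
        rintro _ ⟨e', rfl⟩
        have : e' = 0 := by
          by_contra he'
          exact hc l (kerIso_of_bijective (kerDual_bijective (hη' l) B.isSimple he'))
        rw [this, map_zero]
        exact zero_mem _
      have h1 : w = 0 := (Submodule.mem_bot _).mp (h0 (mem_iSup_range_proj hη' w))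
      rw [h1, map_zero] at hw
      have h2 : e = 0 :=
        dualMap_injective _ _ (proj_surjective i) (hw.symm.trans (map_zero _).symm)
      obtain ⟨k, hk, hk1⟩ := (hη i).exists_ker_ne_one
      refine hk1 (congrArg Subtype.val (he.1 (?_ : e.1 ⟨k, hk⟩ = e.1 1)))
      rw [h2]
      rfl
    have hla := hl.hasAbelianKernel
    obtain ⟨e, he⟩ := (hl.congr hB (C.kerIso_rep l hla)).exists_kerDual (hη i)
    obtain ⟨w, hw⟩ := hj _ (dualMap _ (proj η i) (map_proj η i) e)
    have h1 : (⨆ l', LinearMap.range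
        (dualMap (C.rep l hla).carrier (proj η' l') (map_proj η' l'))).map (j _) ≤
        kerDualVanishing _ _ ⟨x, hxk⟩ := by
      rw [Submodule.map_iSup]
      refine iSup_le fun l' => ?_
      rintro _ ⟨_, ⟨e', rfl⟩, rfl⟩
      rw [← C.dualMap_hom]
      exact dualMap_mem_kerDualVanishing _ _ (hx1 l') ⟨e', rfl⟩
    have h2 := h1 (Submodule.mem_map_of_mem (mem_iSup_range_proj hη' w))
    rw [hw] at h2
    exact congrArg Subtype.val
      (he.1 (h2.trans (kerDual_map_one e).symm) : kerMap (proj η i) (map_proj η i) ⟨x, hxk⟩ = 1)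
  · obtain ⟨i', rfl⟩ := hm i hi
    exact (C.hom_eq_one_iff i' x).mp (hx1 i')

end AdaptedComponents

theorem dominates_fiberProduct (hη : ∀ i, (η i).IsIndecomposable)
    (hη' : ∀ i, (η' i).IsIndecomposable)
    (hna : ∀ ζ : ProfiniteCover G, ζ.IsIndecomposable → ¬ ζ.HasAbelianKernel →
      Cardinal.mk (IsoIndex η' ζ) ≤ Cardinal.mk (IsoIndex η ζ))
    (hab : ∀ A : FiniteSimpleModule G,
      LinearMap.range (isotypicMap A.carrier hη') ≤ LinearMap.range (isotypicMap A.carrier hη) ∧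
      Module.rank (gEnd G A.carrier) (LinearMap.ker (isotypicMap A.carrier hη')) ≤
        Module.rank (gEnd G A.carrier) (LinearMap.ker (isotypicMap A.carrier hη))) :
    (fiberProduct η).Dominates (fiberProduct η') := by
  obtain ⟨m, hm, hmi, -⟩ := exists_injective_index hη'
    (fun ζ hζ h => (hna ζ hζ h).some) fun ζ hζ h => (hna ζ hζ h).some.injective
  have hj : ∀ A : FiniteSimpleModule G, _ := fun A =>
    have := A.isSimple.nontrivial_gEnd
    exists_injective_comp_eq A.isSimple.isUnit_or_eq_zero
      (dualToH2 (A := A.carrier) (hasContinuousSection_fiberProduct_of_isIndecomposable hη))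
      (dualToH2 (A := A.carrier) (hasContinuousSection_fiberProduct_of_isIndecomposable hη'))
      (by
        rw [← range_isotypicMap hη A.isSimple, ← range_isotypicMap hη' A.isSimple]
        exact (hab A).1)
      (by
        rw [← rank_ker_isotypicMap hη A.isSimple, ← rank_ker_isotypicMap hη' A.isSimple]
        exact (hab A).2)
  choose j hj hjS using hj
  obtain ⟨C⟩ := exists_adaptedComponents hη hη' m hmi j hj hjS
  exact ⟨lift C.hom C.map_hom, C.lift_surjective hη hη' hm hj, map_lift _ _⟩

theorem isIso_fiberProduct (hη : ∀ i, (η i).IsIndecomposable)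
    (hη' : ∀ i, (η' i).IsIndecomposable)
    (hna : ∀ ζ : ProfiniteCover G, ζ.IsIndecomposable → ¬ ζ.HasAbelianKernel →
      Cardinal.mk (IsoIndex η ζ) = Cardinal.mk (IsoIndex η' ζ))
    (hab : ∀ A : FiniteSimpleModule G,
      LinearMap.range (isotypicMap A.carrier hη) = LinearMap.range (isotypicMap A.carrier hη') ∧
      Module.rank (gEnd G A.carrier) (LinearMap.ker (isotypicMap A.carrier hη)) =
        Module.rank (gEnd G A.carrier) (LinearMap.ker (isotypicMap A.carrier hη'))) :
    (fiberProduct η).IsIso (fiberProduct η') := by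
  have hequiv := fun ζ hζ h => Cardinal.eq.mp (hna ζ hζ h)
  obtain ⟨m, hm, hmi, hms⟩ := exists_injective_index hη'
    (fun ζ hζ h => (hequiv ζ hζ h).some.symm) fun ζ hζ h => (hequiv ζ hζ h).some.symm.injective
  have hj : ∀ A : FiniteSimpleModule G, _ := fun A =>
    have := A.isSimple.nontrivial_gEnd
    exists_bijective_comp_eq A.isSimple.isUnit_or_eq_zero
      (dualToH2 (A := A.carrier) (hasContinuousSection_fiberProduct_of_isIndecomposable hη))
      (dualToH2 (A := A.carrier) (hasContinuousSection_fiberProduct_of_isIndecomposable hη'))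
      (by
        rw [← range_isotypicMap hη A.isSimple, ← range_isotypicMap hη' A.isSimple]
        exact (hab A).1.symm)
      (by
        rw [← rank_ker_isotypicMap hη A.isSimple, ← rank_ker_isotypicMap hη' A.isSimple]
        exact (hab A).2.symm)
  choose j hj hjS using hj
  obtain ⟨C⟩ := exists_adaptedComponents hη hη' m hmi j (fun A => (hj A).1) hjS
  exact IsIso.of_bijective (lift C.hom C.map_hom) (map_lift _ _)
    ⟨C.lift_injective hη hη' (hms (fun ζ hζ h => (hequiv ζ hζ h).some.symm.surjective) hη)
      fun A => (hj A).2, C.lift_surjective hη hη' hm fun A => (hj A).1⟩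

theorem Dominates.range_isotypicMap_le (h : (fiberProduct η).Dominates (fiberProduct η'))
    (hη : ∀ i, (η i).IsIndecomposable) (hη' : ∀ i, (η' i).IsIndecomposable) {A : Type u}
    [AddCommGroup A] [TopologicalSpace A] [DiscreteTopology A] [DistribMulAction G A]
    (hA : IsSimpleGModule G A) :
    LinearMap.range (isotypicMap A hη') ≤ LinearMap.range (isotypicMap A hη) := by
  obtain ⟨θ, hs, hθ⟩ := h
  rw [range_isotypicMap hη hA, range_isotypicMap hη' hA]
  exact range_dualToH2_le θ hθ _ _

theorem Dominates.rank_ker_isotypicMap_le (h : (fiberProduct η).Dominates (fiberProduct η'))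
    (hη : ∀ i, (η i).IsIndecomposable) (hη' : ∀ i, (η' i).IsIndecomposable) {A : Type u}
    [AddCommGroup A] [TopologicalSpace A] [DiscreteTopology A] [DistribMulAction G A]
    (hA : IsSimpleGModule G A) :
    Module.rank (gEnd G A) (LinearMap.ker (isotypicMap A hη')) ≤
      Module.rank (gEnd G A) (LinearMap.ker (isotypicMap A hη)) := by
  obtain ⟨θ, hs, hθ⟩ := h
  rw [rank_ker_isotypicMap hη hA, rank_ker_isotypicMap hη' hA]
  exact rank_ker_dualToH2_le θ hθ hs _ _

/-- The invariants are cardinals and submodules, so domination in both directions forces equality.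
-/
theorem isIso_of_dominates_of_dominates (hη : ∀ i, (η i).IsIndecomposable)
    (hη' : ∀ i, (η' i).IsIndecomposable) (h : (fiberProduct η).Dominates (fiberProduct η'))
    (h' : (fiberProduct η').Dominates (fiberProduct η)) :
    (fiberProduct η).IsIso (fiberProduct η') :=
  isIso_fiberProduct hη hη'
    (fun _ hζ hna => le_antisymm (h'.mk_isoIndex_le hη' hη hζ hna) (h.mk_isoIndex_le hη hη' hζ hna))
    fun A => ⟨le_antisymm (h'.range_isotypicMap_le hη' hη A.isSimple)
      (h.range_isotypicMap_le hη hη' A.isSimple),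
      le_antisymm (h'.rank_ker_isotypicMap_le hη' hη A.isSimple)
        (h.rank_ker_isotypicMap_le hη hη' A.isSimple)⟩

end Families

end ProfiniteCover

/-! ### The main theorem -/

theorem mainTheorem2 (G : ProfiniteGrp.{u}) {I I' : Type u}
    (η : I → ProfiniteCover G) (η' : I' → ProfiniteCover G)
    (hη : ∀ i, (η i).IsIndecomposable) (hη' : ∀ i, (η' i).IsIndecomposable) :
    ((ProfiniteCover.fiberProduct η).Dominates (ProfiniteCover.fiberProduct η') ↔
      (∀ ζ : ProfiniteCover G, ζ.IsIndecomposable → ¬ ζ.HasAbelianKernel →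
        Cardinal.mk (ProfiniteCover.IsoIndex η' ζ) ≤ Cardinal.mk (ProfiniteCover.IsoIndex η ζ)) ∧
      (∀ (A : Type u) [AddCommGroup A] [Finite A] [TopologicalSpace A] [DiscreteTopology A]
        [DistribMulAction G A] [ContinuousSMul G A], IsSimpleGModule G A →
        LinearMap.range (ProfiniteCover.isotypicMap A hη') ≤
          LinearMap.range (ProfiniteCover.isotypicMap A hη) ∧
        Module.rank (gEnd G A) (LinearMap.ker (ProfiniteCover.isotypicMap A hη')) ≤
          Module.rank (gEnd G A) (LinearMap.ker (ProfiniteCover.isotypicMap A hη)))) ∧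
    ((ProfiniteCover.fiberProduct η).IsIso (ProfiniteCover.fiberProduct η') ↔
      (∀ ζ : ProfiniteCover G, ζ.IsIndecomposable → ¬ ζ.HasAbelianKernel →
        Cardinal.mk (ProfiniteCover.IsoIndex η ζ) = Cardinal.mk (ProfiniteCover.IsoIndex η' ζ)) ∧
      (∀ (A : Type u) [AddCommGroup A] [Finite A] [TopologicalSpace A] [DiscreteTopology A]
        [DistribMulAction G A] [ContinuousSMul G A], IsSimpleGModule G A →
        LinearMap.range (ProfiniteCover.isotypicMap A hη) =
          LinearMap.range (ProfiniteCover.isotypicMap A hη') ∧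
        Module.rank (gEnd G A) (LinearMap.ker (ProfiniteCover.isotypicMap A hη)) =
          Module.rank (gEnd G A) (LinearMap.ker (ProfiniteCover.isotypicMap A hη')))) ∧
    ((ProfiniteCover.fiberProduct η).Dominates (ProfiniteCover.fiberProduct η') →
      (ProfiniteCover.fiberProduct η').Dominates (ProfiniteCover.fiberProduct η) →
      (ProfiniteCover.fiberProduct η).IsIso (ProfiniteCover.fiberProduct η')) := by
  have iso_symm : (ProfiniteCover.fiberProduct η).IsIso (ProfiniteCover.fiberProduct η') →
      (ProfiniteCover.fiberProduct η').Dominates (ProfiniteCover.fiberProduct η) :=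
    fun h => h.symm.dominates
  refine ⟨⟨fun h => ⟨fun ζ hζ hna => h.mk_isoIndex_le hη hη' hζ hna, ?_⟩, fun h => ?_⟩,
    ⟨fun h => ⟨fun ζ hζ hna => ?_, ?_⟩, fun h => ?_⟩,
    ProfiniteCover.isIso_of_dominates_of_dominates hη hη'⟩
  · intro A _ _ _ _ _ _ hA
    exact ⟨h.range_isotypicMap_le hη hη' hA, h.rank_ker_isotypicMap_le hη hη' hA⟩
  · exact ProfiniteCover.dominates_fiberProduct hη hη' h.1 fun A => h.2 A.carrier A.isSimple
  · exact le_antisymm ((iso_symm h).mk_isoIndex_le hη' hη hζ hna)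
      (h.dominates.mk_isoIndex_le hη hη' hζ hna)
  · intro A _ _ _ _ _ _ hA
    exact ⟨le_antisymm ((iso_symm h).range_isotypicMap_le hη' hη hA)
      (h.dominates.range_isotypicMap_le hη hη' hA),
      le_antisymm ((iso_symm h).rank_ker_isotypicMap_le hη' hη hA)
        (h.dominates.rank_ker_isotypicMap_le hη hη' hA)⟩
  · exact ProfiniteCover.isIso_fiberProduct hη hη' h.1 fun A => h.2 A.carrier A.isSimple
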